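/- **Setting.** Let $N\ge1$, $\mathcal S=\{1,\dots,N\}\cup\{\bar1,\dots,\bar N\}$, $\operatorname{sg}(k)=1$, $\operatorname{sg}(\bar k)=-1$. Slow variables are $(\boldsymbol s,\boldsymbol t)$ with $s_a\in\mathbb R$, $\sum_{a\in\mathcal S}s_a=0$, and $t_{ja}\in\mathbb C$ ($j\ge1$), only finitely many $t_{ja}$ being non-zero. Let $U$ be an open set of slow variables (open in all finite-dimensional affine subspaces). For every small $\epsilon>0$ let $$S=1+\varphi_1(n)\Lambda^{-1}+\varphi_2(n)\Lambda^{-2}+\cdots,\qquad \bar S=\bar\varphi_0(n)+\bar\varphi_1(n)\Lambda+\cdots\quad(\bar\varphi_0\text{ invertible}),$$ with $N\times N$ matrix coefficients depending on $n\in\mathbb Z$ and on $(\boldsymbol s,\boldsymbol t)\in U$, be a solution of the multi-component 2D Toda hierarchy: with $\Lambda$ the shift in $n$ and $$W=S\sum_kE_{kk}\Lambda^{s_k/\epsilon}\exp\Big(\sum_{j\ge1}\tfrac{t_{jk}}\epsilon\Lambda^j\Big),\qquad \bar W=\bar S\sum_kE_{kk}\Lambda^{-s_{\bar k}/\epsilon}\exp\Big(\sum_{j\ge1}\tfrac{t_{j\bar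 k}}\epsilon\Lambda^{-j}\Big),$$ one has $W\cdot g=\bar W$ with $g$ independent of $(\boldsymbol s,\boldsymbol t)$, in the formal sense that for every time derivative $\epsilon\,\partial/\partial t_{ja}$ and for every charge preserving shift $T:(s_a,s_b)\mapsto(s_a+\epsilon,s_b-\epsilon)$ there are operators $B$, with finitely many powers of $\Lambda$, such that $\epsilon\,\partial W=BW$, $\epsilon\,\partial\bar W=B\bar W$ (respectively $TW=BW$, $T\bar W=B\bar W$). Let $n=n(\epsilon)\in\mathbb Z$ be sites with $\epsilon\,n(\epsilon)\to n_0\in\mathbb R$ as $\epsilon\to0^+$ (so $n_0=0$ for a fixed site), and assume that at these sites the first row of the wave functions has the quasiclassical form: with $w=z^{-\operatorname{sg}(a)}$, $$1+\sum_{i\ge1}\varphi_{i,11}w^i,\qquad \sum_{i\ge0}\varphi_{i+1,1k}w^i\ (a=k\ne1),\qquad \sum_{i\ge0}\bar\varphi_{i,1k}w^i\ (a=\bar k)$$ are equal to $\exp\big(\epsilon^{-1}\sum_{i\ge0}f_{a,i}w^i\big)$ for $a=1$, $a=k\neq 1$, $a=\bar k$ respectively, with $f_{1,0}=0$, where $f_{a,i}=f_{a,i}(\epsilon;\boldsymbol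 s,\boldsymbol t)$ are smooth in $(\boldsymbol s,\boldsymbol t)$ and holomorphic in the times, and converge as $\epsilon\to0^+$, locally uniformly (on finite-dimensional affine subspaces) together with their first derivatives, to such functions $f^0_{a,i}$. Put $$\mathscr S_{a,0}=(n_0+\operatorname{sg}(a)s_a)\log z+\sum_{j\ge1}t_{ja}z^{\operatorname{sg}(a)j}+\sum_{i\ge0}f^0_{a,i}\,z^{-\operatorname{sg}(a)i},\qquad x=t_{11},\qquad \partial_a=\partial_{s_a}-\partial_{s_1},\qquad q_a=\partial_af^0_{1,1}\quad(a\ne1).$$ All series below are formal Laurent series in the local parameter at the puncture $a$, namely $1/p$ for $a=1$ and $p-q_a$ for $a\ne1$. The Lax function $z_a$ (for which $z_a^{-\operatorname{sg}(a)}$ is a series in positive powers of the local parameter) and the Orlov–Schulman function $m_a$ are defined by $$p=\partial_x\mathscr S_{a,0}\big|_{z=z_a},\qquad m_a=\frac{\partial\mathscr S_{a,0}}{\partial z}\Big|_{z=z_a}.$$ **Proposition.** At every point of $U$: 1. $z_a$ exists and is unique for every $a\in\mathcal S$, and $$z_1=p+\ell_{1,0}+O(p^{-1})\ (p\to\infty),\qquad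 z_a^{\operatorname{sg}(a)}=\frac{\ell_{a,1}}{p-q_a}+\ell_{a,0}+O(p-q_a)\ (p\to q_a),\quad \ell_{a,1}\ne0,\quad a\neq1.$$ 2. For suitable coefficients $\mu_{aj}$ (for $a=1$ and any choice of $a_0\ne1$, with $\mu_{1j}$ depending on $a_0$), $$m_a=(n_0+\operatorname{sg}(a)s_a)z_a^{-1}+\operatorname{sg}(a)\sum_{j\ge1}j\,t_{ja}\,z_a^{\operatorname{sg}(a)j-1}+z_a^{-1}\begin{cases}\sum_{j\ge1}\mu_{1j}(p-q_{a_0})^{-j},&a=1,\\ \sum_{j\ge1}\mu_{aj}(p-q_a)^{j},&a\ne1.\end{cases}$$ 3. The $\mathscr S_{b,0}$ give a solution of the zero-genus Whitham hierarchy with $2N$ punctures in the KP picture, with inverse local coordinates $Z_a=z_a^{\operatorname{sg}(a)}$: the $q_a$ ($a\ne1$) are pairwise distinct, $\ell_{1,0}=0$, the $q_a$ and the coefficients of the $Z_a$ are smooth on $U$ and holomorphic in the times, and for all $b\in\mathcal S$, with derivatives taken at constant $z$, $$\frac{\partial\mathscr S_{b,0}}{\partial t_{ja}}\Big|_{z=z_b}=\Omega_{ja}\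 (j\ge1,\ a\in\mathcal S),\qquad \partial_a\mathscr S_{b,0}\big|_{z=z_b}=-\log(p-q_a)\ (a\ne1),$$ where $\Omega_{ja}=(Z_a^{\,j})_{(a,+)}$ is the projection on the span of $\{p^n\}_{n\ge0}$ for $a=1$ (so that $\Omega_{11}=p$) and of $\{(p-q_a)^{-n}\}_{n\ge1}$ for $a\ne1$, expanded at the puncture $b$, and the identity with the multivalued logarithm is understood after exponentiation. Equivalently, $d\mathscr S_{b,0}=m_b\,dz_b+p\,dx-\sum_{a\ne1}\log(p-q_a)\,ds_a+\sum'_{j,a}\Omega_{ja}\,dt_{ja}$, where $\sum'$ omits $(j,a)=(1,1)$. -/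

import Mathlib

open scoped ContDiff Topology

noncomputable section

namespace WhithamKP

/-! ## Indices, times and slow variables -/

/-- The index set `𝒮 = {1, …, N} ∪ {1̄, …, N̄}`: `Sum.inl k` is unbarred, `Sum.inr k` is barred. -/
abbrev Idx (N : ℕ) : Type := Fin N ⊕ Fin N

/-- `sg a = 1` for unbarred and `sg a = -1` for barred indices. -/
def sg {N : ℕ} : Idx N → ℤ
  | Sum.inl _ => 1
  | Sum.inr _ => -1

/-- The distinguished index `1`. -/
def one {N : ℕ} [NeZero N] : Idx N := Sum.inl 0

/-- The charges `s_a` and the times `t_{ja}` (`x.2 a j` is `t_{ja}`, `j ≥ 1`); only finitely many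
times are different from zero. -/
abbrev AllTimes (N : ℕ) : Type := (Idx N → ℝ) × (Idx N → ℕ+ →₀ ℂ)

/-- The total charge `∑ₐ s_a`. -/
def charge (N : ℕ) : AllTimes N →ₗ[ℝ] ℝ :=
  ∑ a : Idx N, (LinearMap.proj a).comp (LinearMap.fst ℝ (Idx N → ℝ) (Idx N → ℕ+ →₀ ℂ))

/-- The slow variables `(s, t)` in the zero charge sector. -/
abbrev Slow (N : ℕ) : Type := LinearMap.ker (charge N)

/-- The direction `s_a ↦ s_a + 1`, `s_b ↦ s_b - 1`. -/
def dirS {N : ℕ} (a b : Idx N) : Slow N :=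
  ⟨(Pi.single a 1 - Pi.single b 1, 0), by
    simp [charge, LinearMap.mem_ker, -Fintype.sum_sum_type]⟩

/-- The direction of the time `t_{ja}`, with complex step `c`. -/
def dirT {N : ℕ} (a : Idx N) (j : ℕ+) (c : ℂ) : Slow N :=
  ⟨(0, Pi.single a (Finsupp.single j c)), by simp [charge, LinearMap.mem_ker]⟩

/-- Open sets of slow variables: the intersections with all finite-dimensional affine subspaces
are open. -/
def IsSlowOpen {N : ℕ} (U : Set (Slow N)) : Prop :=
  ∀ (x : Slow N) (d : ℕ) (L : (Fin d → ℝ) →ₗ[ℝ] Slow N), IsOpen {c | x + L c ∈ U}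

/-- Smooth functions of the slow variables on `U`, holomorphic in each of the times: smoothness is
tested on all finite-dimensional affine subspaces. -/
def IsSlowFunction {N : ℕ} (U : Set (Slow N)) (g : Slow N → ℂ) : Prop :=
  (∀ (x : Slow N) (d : ℕ) (L : (Fin d → ℝ) →ₗ[ℝ] Slow N),
    ContDiffOn ℝ ∞ (fun c => g (x + L c)) {c | x + L c ∈ U}) ∧
  ∀ x ∈ U, ∀ (a : Idx N) (j : ℕ+), DifferentiableAt ℂ (fun τ : ℂ => g (x + dirT a j τ)) 0

/-! ## The multi-component 2D Toda hierarchy -/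

/-- A formal series `∑ₘ Xₘ(n) Λᵐ` in the shift operator `Λ`, with `N × N` matrix coefficients:
`X m n` is the coefficient `Xₘ(n)`. -/
abbrev Op (N : ℕ) : Type := ℤ → ℤ → Matrix (Fin N) (Fin N) ℂ

/-- The product `B · X`, where `B` has finitely many powers of `Λ`; recall
`(Y(n) Λⁱ) (Z(n) Λʲ) = Y(n) Z(n + i) Λⁱ⁺ʲ`. -/
def bandMul {N : ℕ} (B : ℤ →₀ (ℤ → Matrix (Fin N) (Fin N) ℂ)) (X : Op N) : Op N :=
  fun m n => B.sum fun i b => b n * X (m - i) (n + i)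

/-- The product `X · E_{kk} Λⁱ`. -/
def mulUnit {N : ℕ} (X : Op N) (k : Fin N) (i : ℤ) : Op N :=
  fun m n => X (m - i) n * Matrix.single k k 1

/-- The product `X · ∑ₖ E_{kk} Λ^{d k}`. -/
def mulShift {N : ℕ} (X : Op N) (d : Fin N → ℤ) : Op N :=
  fun m n => Matrix.of fun r c => X (m - d c) n r c

/-- `D` is the derivative at `x` of the operator-valued function `X` in the time `t_{ja}`. -/
def HasOpTimeDeriv {N : ℕ} (X : Slow N → Op N) (a : Idx N) (j : ℕ+) (x : Slow N) (D : Op N) :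
    Prop :=
  ∀ m n r c, HasDerivAt (fun τ : ℂ => X (x + dirT a j τ) m n r c) (D m n r c) 0

/-- `S` and `Sb` (that is, `S̄`) are the factors of a solution of the multi-component 2D Toda
hierarchy in the slow variables `ε s`, `ε t`, on the domain `U`:
`S = 1 + φ₁(n) Λ⁻¹ + ⋯`, `S̄ = φ̄₀(n) + φ̄₁(n) Λ + ⋯` with `φ̄₀` invertible, and the dressing
operators `W = S W₀`, `W̄ = S̄ W̄₀`, where
`W₀ = ∑ₖ E_{kk} Λ^{s_k} exp (∑ⱼ t_{jk} Λʲ)` and `W̄₀ = ∑ₖ E_{kk} Λ^{-s_k̄} exp (∑ⱼ t_{jk̄} Λ⁻ʲ)`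
(fast variables), satisfy `W · g = W̄` with `g` independent of `(s, t)`.

As usual for formal series, constancy of the formal quotient `g = W⁻¹ W̄` is expressed without
forming ill-defined products of two-sided infinite series: in every time, `∂W · W⁻¹ = ∂W̄ · W̄⁻¹`,
and for every charge preserving shift `T`, `(T W) · W⁻¹ = (T W̄) · W̄⁻¹`. The left sides are bounded
above and the right sides are bounded below in powers of `Λ`, so that the common value is an
operator `B` with finitely many powers of `Λ`; the equations below are `∂W = B W`, `∂W̄ = B W̄`,
`T W = B W`, `T W̄ = B W̄`, with the explicit factors `W₀`, `W̄₀` cancelled on the right. -/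
structure IsTodaSolution {N : ℕ} (ε : ℝ) (U : Set (Slow N)) (S Sb : Slow N → Op N) : Prop where
  lower : ∀ x ∈ U, ∀ n, S x 0 n = 1 ∧ ∀ m, 0 < m → S x m n = 0
  upper : ∀ x ∈ U, ∀ n, IsUnit (Sb x 0 n) ∧ ∀ m, m < 0 → Sb x m n = 0
  time_unbarred : ∀ x ∈ U, ∀ (k : Fin N) (j : ℕ+), ∃ B dS dSb,
    HasOpTimeDeriv S (Sum.inl k) j x dS ∧ HasOpTimeDeriv Sb (Sum.inl k) j x dSb ∧
    (ε : ℂ) • dS + mulUnit (S x) k (j : ℤ) = bandMul B (S x) ∧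
    (ε : ℂ) • dSb = bandMul B (Sb x)
  time_barred : ∀ x ∈ U, ∀ (k : Fin N) (j : ℕ+), ∃ B dS dSb,
    HasOpTimeDeriv S (Sum.inr k) j x dS ∧ HasOpTimeDeriv Sb (Sum.inr k) j x dSb ∧
    (ε : ℂ) • dS = bandMul B (S x) ∧
    (ε : ℂ) • dSb + mulUnit (Sb x) k (-(j : ℤ)) = bandMul B (Sb x)
  shift : ∀ x ∈ U, ∀ a b : Idx N, a ≠ b → x + ε • dirS a b ∈ U → ∃ B,
    mulShift (S (x + ε • dirS a b)) (fun k =>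
      (if Sum.inl k = a then 1 else 0) - (if Sum.inl k = b then 1 else 0)) = bandMul B (S x) ∧
    mulShift (Sb (x + ε • dirS a b)) (fun k =>
      (if Sum.inr k = b then 1 else 0) - (if Sum.inr k = a then 1 else 0)) = bandMul B (Sb x)

/-! ## Formal series -/

/-- The exponential of a formal power series (with arbitrary constant term). -/
def expSeries (g : PowerSeries ℂ) : PowerSeries ℂ :=
  PowerSeries.C (Complex.exp (PowerSeries.constantCoeff g)) *
    (PowerSeries.exp ℂ).subst (g - PowerSeries.C (PowerSeries.constantCoeff g))

/-- The composition `F(g)` of Laurent series, for `g` a series in positive powers. -/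
def comp (F g : LaurentSeries ℂ) : LaurentSeries ℂ :=
  g ^ F.order *
    ((F.powerSeriesPart.subst (PowerSeries.mk fun i : ℕ => g.coeff i) : PowerSeries ℂ) :
      LaurentSeries ℂ)

/-- `log · log Z + ser(w)`, a formal function near a puncture with local coordinate `w = 1 / Z`. -/
structure Phase where
  log : ℂ
  ser : LaurentSeries ℂ

/-- The derivative with respect to `z`, for `Z = z ^ σ` with `σ = 1` or `σ = -1`, as a Laurent
series in `w = z ^ (-σ)`: it is `σ z⁻¹ (log - w d/dw ser)`. -/
def Phase.dz (σ : ℤ) (P : Phase) : LaurentSeries ℂ :=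
  (σ : ℂ) • (HahnSeries.single σ 1 *
    (HahnSeries.C P.log - HahnSeries.single 1 1 * LaurentSeries.derivative ℂ P.ser))

/-- `P` is the derivative at `x` of the phase `S` in the time `t_{ja}`, at constant `z`. -/
def HasTimeDeriv {N : ℕ} (S : Slow N → Phase) (a : Idx N) (j : ℕ+) (x : Slow N) (P : Phase) :
    Prop :=
  HasDerivAt (fun τ : ℂ => (S (x + dirT a j τ)).log) P.log 0 ∧
  ∀ i, HasDerivAt (fun τ : ℂ => (S (x + dirT a j τ)).ser.coeff i) (P.ser.coeff i) 0

/-- `P` is the derivative `∂S/∂s_a - ∂S/∂s_1` at `x`, at constant `z`; in the coordinates `s_a`,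
`a ≠ 1`, of the zero charge sector this is the derivative in `s_a`. -/
def HasChargeDeriv {N : ℕ} [NeZero N] (S : Slow N → Phase) (a : Idx N) (x : Slow N) (P : Phase) :
    Prop :=
  HasDerivAt (fun τ : ℝ => (S (x + τ • dirS a one)).log) P.log 0 ∧
  ∀ i, HasDerivAt (fun τ : ℝ => (S (x + τ • dirS a one)).ser.coeff i) (P.ser.coeff i) 0

/-! ## The quasiclassical form of the wave functions -/

/-- The formal series of the component `Ψ_a` of the first row of the wave functions at the site `n`,
in the variable `w = z ^ (-sg a)`, divided by
`z^{n + s_1} exp (∑ⱼ t_{j1} zʲ)` for `a = 1`, by `z^{n + s_k - 1} exp (∑ⱼ t_{jk} zʲ)` for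
`a = k ≠ 1`, and by `z^{n - s_k̄} exp (∑ⱼ t_{jk̄} z⁻ʲ)` for `a = k̄` (fast variables). -/
def waveSeries {N : ℕ} [NeZero N] (S Sb : Op N) (n : ℤ) : Idx N → PowerSeries ℂ
  | Sum.inl k => PowerSeries.mk fun i =>
      if k = 0 then S (-(i : ℤ)) n 0 0 else S (-((i : ℤ) + 1)) n 0 k
  | Sum.inr k => PowerSeries.mk fun i => Sb (i : ℤ) n 0 k

/-- The wave functions at the sites `n ε` have the quasiclassical form `Ψ_a = exp (𝒮_a / ε)` on `U`,
for small `ε > 0`, where `𝒮_a` is the sum of the explicit terms (see `waveSeries` and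
`leadingPhase`) and of `∑ᵢ f a i ε wⁱ`, and the coefficients converge together with their first
derivatives, locally uniformly on finite-dimensional affine subspaces, to `f₀ a i`. -/
structure IsQuasiclassical {N : ℕ} [NeZero N] (ε₀ : ℝ) (U : Set (Slow N))
    (S Sb : ℝ → Slow N → Op N) (n : ℝ → ℤ)
    (f : Idx N → ℕ → ℝ → Slow N → ℂ) (f₀ : Idx N → ℕ → Slow N → ℂ) : Prop where
  normalized : ∀ ε ∈ Set.Ioo 0 ε₀, ∀ x ∈ U, f one 0 ε x = 0
  wave : ∀ ε ∈ Set.Ioo 0 ε₀, ∀ x ∈ U, ∀ a,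
    waveSeries (S ε x) (Sb ε x) (n ε) a = expSeries (PowerSeries.mk fun i => f a i ε x / ε)
  regular : ∀ ε ∈ Set.Ioo 0 ε₀, ∀ a i, IsSlowFunction U (f a i ε)
  regular_limit : ∀ a i, IsSlowFunction U (f₀ a i)
  limit : ∀ a i (x : Slow N) (d : ℕ) (L : (Fin d → ℝ) →ₗ[ℝ] Slow N),
    TendstoLocallyUniformlyOn (fun ε c => f a i ε (x + L c)) (fun c => f₀ a i (x + L c))
      (𝓝[>] 0) {c | x + L c ∈ U}
  limit_deriv : ∀ a i (x : Slow N) (d : ℕ) (L : (Fin d → ℝ) →ₗ[ℝ] Slow N),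
    TendstoLocallyUniformlyOn (fun ε => fderiv ℝ fun c => f a i ε (x + L c))
      (fderiv ℝ fun c => f₀ a i (x + L c)) (𝓝[>] 0) {c | x + L c ∈ U}

/-- The leading phase
`𝒮_{a,0} = (n₀ + sg(a) s_a) log z + ∑ⱼ t_{ja} z^{sg(a) j} + ∑ᵢ f₀ a i z^{-sg(a) i}`,
with `Z = z ^ sg(a)`. -/
def leadingPhase {N : ℕ} (n₀ : ℝ) (f₀ : Idx N → ℕ → Slow N → ℂ) (a : Idx N) (x : Slow N) : Phase where
  log := (sg a : ℂ) * n₀ + (x.1.1 a : ℝ)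
  ser := ((x.1.2 a).sum fun j c => HahnSeries.single (-(j : ℤ)) c) +
    ((PowerSeries.mk fun i => f₀ a i x : PowerSeries ℂ) : LaurentSeries ℂ)

/-! ## The KP picture -/

/-- The function `q_a` (`a ≠ 1`): the derivative `∂_a = ∂/∂s_a - ∂/∂s_1` of the limit of
`ε φ_{1,11}`, i.e. of the coefficient of `z⁻¹` in `𝒮_{1,0}`. -/
def puncture {N : ℕ} [NeZero N] (f₀ : Idx N → ℕ → Slow N → ℂ) (a : Idx N) (x : Slow N) : ℂ :=
  deriv (fun τ : ℝ => f₀ one 1 (x + τ • dirS a one)) 0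

/-- The variable `p` as a Laurent series in the local parameter `ξ` at the puncture `a`, where
`ξ = 1 / p` for `a = 1` and `ξ = p - q_a` for `a ≠ 1`. -/
def pAt {N : ℕ} [NeZero N] (q : Idx N → ℂ) (a : Idx N) : LaurentSeries ℂ :=
  if a = one then HahnSeries.single (-1) 1 else HahnSeries.C (q a) + HahnSeries.single 1 1

/-- `z`, a Laurent series in the local parameter at the puncture `a`, is the dispersionless Lax
function `z_a` at `x`: it satisfies `p = ∂𝒮_{a,0}/∂t_{11}` at `z`, where `z ^ (-sg a)` is a series
in positive powers of the local parameter. -/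
def IsLaxFunction {N : ℕ} [NeZero N] (q : Idx N → Slow N → ℂ) (S : Idx N → Slow N → Phase)
    (a : Idx N) (x : Slow N) (z : LaurentSeries ℂ) : Prop :=
  (∀ i ≤ 0, (z ^ (-sg a)).coeff i = 0) ∧
  ∃ P : Phase, HasTimeDeriv (S a) one 1 x P ∧ P.log = 0 ∧
    comp P.ser (z ^ (-sg a)) = pAt (fun b => q b x) a

/-- The dispersionless Orlov–Schulman function `m_a = ∂𝒮_{a,0}/∂z` at `z = z_a`. -/
def orlov {N : ℕ} (S : Idx N → Slow N → Phase) (a : Idx N) (x : Slow N) (z : LaurentSeries ℂ) :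
    LaurentSeries ℂ :=
  comp ((S a x).dz (sg a)) (z ^ (-sg a))

/-- The functions `Ω_{ja} = (Z_aʲ)_{(a,+)}` (`j ≥ 1`) of the KP picture, evaluated at `P`: the
projection on the span of `pⁿ`, `n ≥ 0`, for `a = 1`, and of `(p - q_a)⁻ⁿ`, `n ≥ 1`, for `a ≠ 1`. -/
def Omega {N : ℕ} [NeZero N] (q : Idx N → ℂ) (Z : Idx N → LaurentSeries ℂ) (a : Idx N) (j : ℕ)
    (P : LaurentSeries ℂ) : LaurentSeries ℂ :=
  if a = one then ∑ n ∈ Finset.range (j + 1), (Z a ^ j).coeff (-(n : ℤ)) • P ^ n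
  else ∑ n ∈ Finset.Icc 1 j, (Z a ^ j).coeff (-(n : ℤ)) • (P - HahnSeries.C (q a))⁻¹ ^ n

/-- A solution on `U` of the zero-genus Whitham hierarchy with `2 N` punctures `q_1 = ∞` and `q_a`
(`a ≠ 1`), in the KP picture. The data are the punctures `q`, the inverses `Z a` of the local
coordinates, and local functions `S a` around the punctures with
`∂S_b/∂t_A (Z_b) = Ω_A(p(Z_b))` for all flows `A`, where the derivative is taken at constant `Z_b`,
`Ω_{ja} = (Z_aʲ)_{(a,+)}` for `A = (j, a)`, `j ≥ 1` (in particular `Ω_{11} = p`), and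
`Ω_{0a} = -log (p - q_a)` for `A = (0, a)`, `a ≠ 1`, with time `s_a`. The logarithm being
multivalued, the last condition is written as `exp (∂S_b/∂s_a) = (p - q_a)⁻¹`, where the left side
is `Z_bᵏ exp (g(1 / Z_b))` if `∂S_b/∂s_a = k log Z_b + g(1 / Z_b)`. -/
structure IsKPWhithamSolution {N : ℕ} [NeZero N] (U : Set (Slow N)) (q : Idx N → Slow N → ℂ)
    (Z : Idx N → Slow N → LaurentSeries ℂ) (S : Idx N → Slow N → Phase) : Prop where
  distinct : ∀ x ∈ U, ∀ a b, a ≠ one → b ≠ one → a ≠ b → q a x ≠ q b x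
  at_infinity : ∀ x ∈ U, ∃ r : PowerSeries ℂ,
    Z one x = HahnSeries.single (-1) 1 + HahnSeries.single 1 1 * (r : LaurentSeries ℂ)
  at_finite : ∀ x ∈ U, ∀ a, a ≠ one → ∃ (ℓ : ℂ) (r : PowerSeries ℂ), ℓ ≠ 0 ∧
    Z a x = HahnSeries.single (-1) ℓ + (r : LaurentSeries ℂ)
  regular_q : ∀ a, a ≠ one → IsSlowFunction U (q a)
  regular_Z : ∀ a i, IsSlowFunction U fun x => (Z a x).coeff i
  time_flow : ∀ x ∈ U, ∀ (a : Idx N) (j : ℕ+) (b : Idx N),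
    ∃ P : Phase, HasTimeDeriv (S b) a j x P ∧ P.log = 0 ∧
      comp P.ser (Z b x)⁻¹ =
        Omega (fun c => q c x) (fun c => Z c x) a j (pAt (fun c => q c x) b)
  charge_flow : ∀ x ∈ U, ∀ a, a ≠ one → ∀ b : Idx N,
    ∃ (P : Phase) (k : ℤ) (g : PowerSeries ℂ), HasChargeDeriv (S b) a x P ∧ P.log = k ∧
      P.ser = (g : LaurentSeries ℂ) ∧
      Z b x ^ k * comp (expSeries g : LaurentSeries ℂ) (Z b x)⁻¹ =
        (pAt (fun c => q c x) b - HahnSeries.C (q a x))⁻¹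

end WhithamKP

end

open WhithamKP

/-! Fix `ε` and a point of `U`. Time derivatives and charge shifts act on the pair (W, W̄) through
left multiplication by operators with finitely many powers of Λ. Hence the logarithmic time
derivatives of the first-row wave functions, and the ratios of shifted to unshifted ones, all lie in
one vector space `quotMod` of tuples of Laurent series, one series per puncture. A Liouville theorem
holds there (`eq_zero_of_mem_quotMod`): a tuple without poles whose value at the puncture 1 is zero
vanishes, because S begins with 1 and S̄ with an invertible coefficient.

The logarithmic derivative in t_{ja} has its only pole at a, of order j. The ratio for k shifts
(s_a, s_b) ↦ (s_a + ε, s_b - ε) has a pole of exact order k at a and no other pole. A triangular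
linear system therefore writes the derivative as a combination of such ratios
(`exists_combination`). As ε → 0 the k-fold ratio tends to Eᵏ, where E = exp((∂_{s_a} - ∂_{s_b})𝒮),
and the limiting determinant is non-zero, so Cramer's rule carries the identity to the limit:
∂𝒮/∂t_{ja} is a polynomial in E, with the same coefficients at every puncture (`timeSer_eq`).

For t_{11} the polynomial has degree one, and two coefficients at the puncture 1 determine it:
exp(-∂_a 𝒮_b) = p - q_a (`chargeExp_eq`). Consequently p - q_a is a local parameter at a, the q_a
are distinct, and the Lax function comes from the compositional inverse of the local parameter
(`exists_localCoord`). Every ∂𝒮/∂t_{ja} becomes a polynomial in p, or in 1/(p - q_a), fixed by its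
principal part at a, which is that of Z_aʲ; this is Ω_{ja}. -/

noncomputable section

namespace WhithamKP

/-! ## Exponentials of formal series -/

section ExpSeries

open PowerSeries

lemma hasSubst_sub_C (g : PowerSeries ℂ) : HasSubst (g - C (constantCoeff g)) :=
  HasSubst.of_constantCoeff_zero' (by simp)

lemma constantCoeff_expSeries (g : PowerSeries ℂ) :
    constantCoeff (expSeries g) = Complex.exp (constantCoeff g) := by
  have h : constantCoeff ((PowerSeries.exp ℂ).subst (g - C (constantCoeff g))) = (1 : ℂ) := by
    have h1 : PowerSeries.exp ℂ = 1 + (PowerSeries.exp ℂ - 1) := by ring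
    have h2 : (1 : PowerSeries ℂ).subst (g - C (constantCoeff g)) = (1 : PowerSeries ℂ) := by
      rw [← coe_substAlgHom (hasSubst_sub_C g), map_one]
    rw [h1, subst_add (hasSubst_sub_C g), h2, map_add]
    have := constantCoeff_subst_eq_zero (a := g - C (constantCoeff g)) (by simp [← PowerSeries.constantCoeff.eq_def])
      (PowerSeries.exp ℂ - 1) (by simp)
    rw [← PowerSeries.constantCoeff.eq_def] at this
    simpa using this
  simp [expSeries, h]

lemma derivative_expSeries (g : PowerSeries ℂ) :
    d⁄dX ℂ (expSeries g) = d⁄dX ℂ g * expSeries g := by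
  simp only [expSeries, Derivation.leibniz, derivative_C, derivative_subst (hasSubst_sub_C g),
    derivative_exp, map_sub, smul_eq_mul]
  ring

/-- The equation `E' = g' E`, read on coefficients, is a recursion. Uniqueness, limits and
derivatives of the exponential follow from it by strong induction. -/
lemma coeff_succ_expSeries (g : PowerSeries ℂ) (m : ℕ) :
    coeff (m + 1) (expSeries g) = ((m : ℂ) + 1)⁻¹ *
      ∑ p ∈ Finset.HasAntidiagonal.antidiagonal m, coeff (p.1 + 1) g * (p.1 + 1) * coeff p.2 (expSeries g) := by
  have h := congrArg (coeff m) (derivative_expSeries g)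
  rw [coeff_derivative, coeff_mul] at h
  simp only [coeff_derivative] at h
  rw [← h]
  have : (m : ℂ) + 1 ≠ 0 := by exact_mod_cast m.succ_ne_zero
  field_simp

/-- The differential equation has one formal solution with a given constant term, so identities
between exponentials reduce to comparing derivatives. -/
lemma eq_expSeries {g E : PowerSeries ℂ}
    (h0 : constantCoeff E = Complex.exp (constantCoeff g)) (h : d⁄dX ℂ E = d⁄dX ℂ g * E) :
    E = expSeries g := by
  ext m
  induction m using Nat.strong_induction_on with
  | _ m ih =>
    cases m with
    | zero => simpa [constantCoeff_expSeries] using h0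
    | succ m =>
      have h1 := congrArg (coeff m) h
      rw [coeff_derivative, coeff_mul] at h1
      simp only [coeff_derivative] at h1
      have h2 : (m : ℂ) + 1 ≠ 0 := by exact_mod_cast m.succ_ne_zero
      rw [coeff_succ_expSeries, eq_inv_mul_iff_mul_eq₀ h2, mul_comm, h1]
      refine Finset.sum_congr rfl fun p hp => ?_
      rw [ih p.2 (by have := Finset.HasAntidiagonal.mem_antidiagonal.1 hp; omega)]

lemma expSeries_zero : expSeries 0 = 1 :=
  (eq_expSeries (by simp) (by simp)).symm

lemma expSeries_add (g h : PowerSeries ℂ) : expSeries (g + h) = expSeries g * expSeries h := by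
  refine (eq_expSeries ?_ ?_).symm
  · simp [constantCoeff_expSeries, Complex.exp_add]
  · simp only [Derivation.leibniz, derivative_expSeries, map_add, smul_eq_mul]
    ring

lemma expSeries_nsmul (k : ℕ) (g : PowerSeries ℂ) : expSeries (k • g) = expSeries g ^ k := by
  induction k with
  | zero => simp [expSeries_zero]
  | succ k ih => rw [succ_nsmul, expSeries_add, ih, pow_succ]

lemma expSeries_mul_neg (g : PowerSeries ℂ) : expSeries g * expSeries (-g) = 1 := by
  rw [← expSeries_add, add_neg_cancel, expSeries_zero]

lemma expSeries_ne_zero (g : PowerSeries ℂ) : expSeries g ≠ 0 := fun h => by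
  simpa [h] using expSeries_mul_neg g

lemma tendsto_coeff_expSeries {ι : Type*} {l : Filter ι} {G : ι → PowerSeries ℂ}
    {g : PowerSeries ℂ} (h : ∀ m, Filter.Tendsto (fun i => coeff m (G i)) l (𝓝 (coeff m g)))
    (m : ℕ) :
    Filter.Tendsto (fun i => coeff m (expSeries (G i))) l (𝓝 (coeff m (expSeries g))) := by
  induction m using Nat.strong_induction_on with
  | _ m ih =>
    cases m with
    | zero =>
      have h0 := h 0
      simp only [coeff_zero_eq_constantCoeff, constantCoeff_expSeries] at h0 ⊢
      exact (Complex.continuous_exp.tendsto _).comp h0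
    | succ m =>
      simp only [coeff_succ_expSeries]
      refine Filter.Tendsto.const_mul _ (tendsto_finsetSum _ fun p hp => ?_)
      exact ((h _).mul_const _).mul (ih p.2 (by have := Finset.HasAntidiagonal.mem_antidiagonal.1 hp; omega))

lemma hasDerivAt_coeff_expSeries {G : ℂ → PowerSeries ℂ} {g' : PowerSeries ℂ} {z : ℂ}
    (h : ∀ m, HasDerivAt (fun τ => coeff m (G τ)) (coeff m g') z) (m : ℕ) :
    HasDerivAt (fun τ => coeff m (expSeries (G τ))) (coeff m (g' * expSeries (G z))) z := by
  induction m using Nat.strong_induction_on with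
  | _ m ih =>
    cases m with
    | zero =>
      have h0 := h 0
      simp only [coeff_zero_eq_constantCoeff, constantCoeff_expSeries, map_mul] at h0 ⊢
      rw [mul_comm]
      exact h0.cexp
    | succ m =>
      simp only [coeff_succ_expSeries]
      -- The differentiated recursion is coefficient `m` of `(g' E)' = (g')' E + G' (g' E)`.
      have key : ((m : ℂ) + 1)⁻¹ * ∑ p ∈ Finset.HasAntidiagonal.antidiagonal m,
          (coeff (p.1 + 1) g' * (p.1 + 1) * coeff p.2 (expSeries (G z)) +
            coeff (p.1 + 1) (G z) * (p.1 + 1) * coeff p.2 (g' * expSeries (G z))) =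
          coeff (m + 1) (g' * expSeries (G z)) := by
        have h1 := congrArg (coeff m) (show d⁄dX ℂ (g' * expSeries (G z)) =
          d⁄dX ℂ g' * expSeries (G z) + d⁄dX ℂ (G z) * (g' * expSeries (G z)) by
            simp only [Derivation.leibniz, derivative_expSeries, smul_eq_mul]; ring)
        rw [coeff_derivative, map_add, coeff_mul m (d⁄dX ℂ g'), coeff_mul m (d⁄dX ℂ (G z)),
          ← Finset.sum_add_distrib] at h1
        simp only [coeff_derivative] at h1
        have h2 : (m : ℂ) + 1 ≠ 0 := by exact_mod_cast m.succ_ne_zero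
        rw [← h1]
        field_simp
      rw [← key]
      refine HasDerivAt.const_mul _ (HasDerivAt.fun_sum fun p hp => ?_)
      exact ((h _).mul_const _).mul (ih p.2 (by have := Finset.HasAntidiagonal.mem_antidiagonal.1 hp; omega))

end ExpSeries

/-! ## Composition of Laurent series -/

section Comp

open PowerSeries HahnSeries

lemma single_zpow_one (k : ℤ) :
    (HahnSeries.single k (1 : ℂ) : LaurentSeries ℂ) = HahnSeries.single 1 1 ^ k :=
  RatFunc.single_zpow k

/-- Substitution of a non-zero power series without constant term into Laurent series. -/
def laurentSubst (W : PowerSeries ℂ) (h0 : constantCoeff W = 0) (hW : W ≠ 0) :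
    LaurentSeries ℂ →+* LaurentSeries ℂ :=
  IsLocalization.lift (M := Submonoid.powers (X : PowerSeries ℂ))
    (g := (ofPowerSeries ℤ ℂ).comp
      (substAlgHom (R := ℂ) (HasSubst.of_constantCoeff_zero' h0)).toRingHom) (by
    rintro ⟨_, m, rfl⟩
    rw [isUnit_iff_ne_zero]
    simp [substAlgHom_X, ofPowerSeries_injective.eq_iff' (map_zero _), hW])

variable {W : PowerSeries ℂ} (h0 : constantCoeff W = 0) (hW : W ≠ 0)

lemma laurentSubst_coe (G : PowerSeries ℂ) :
    laurentSubst W h0 hW (G : LaurentSeries ℂ) = ((G.subst W : PowerSeries ℂ) : LaurentSeries ℂ) := by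
  refine (IsLocalization.lift_eq _ G).trans ?_
  simp [coe_substAlgHom]

lemma laurentSubst_C (c : ℂ) : laurentSubst W h0 hW (HahnSeries.C c) = HahnSeries.C c := by
  rw [← PowerSeries.coe_C, laurentSubst_coe]
  congr 1
  exact subst_C c

lemma laurentSubst_smul (c : ℂ) (F : LaurentSeries ℂ) :
    laurentSubst W h0 hW (c • F) = c • laurentSubst W h0 hW F := by
  rw [← HahnSeries.C_mul_eq_smul, map_mul, laurentSubst_C, HahnSeries.C_mul_eq_smul]

lemma laurentSubst_single (k : ℤ) :
    laurentSubst W h0 hW (HahnSeries.single k 1) = (W : LaurentSeries ℂ) ^ k := by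
  rw [single_zpow_one, map_zpow₀, ← PowerSeries.coe_X, laurentSubst_coe,
    subst_X (HasSubst.of_constantCoeff_zero' h0)]

/-- The definition of `comp` through the order and the power series part is not visibly
multiplicative; as a ring homomorphism it respects sums, products and inverses. -/
lemma comp_coe (F : LaurentSeries ℂ) :
    comp F (W : LaurentSeries ℂ) = laurentSubst W h0 hW F := by
  conv_rhs => rw [← F.single_order_mul_powerSeriesPart, map_mul, laurentSubst_single,
    laurentSubst_coe]
  have : (PowerSeries.mk fun i : ℕ => (W : LaurentSeries ℂ).coeff i) = W := by
    ext i; simp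
  rw [comp, this]

/-- Serves to exclude the degenerate candidate `z ^ (-sg a) = 0`, since `p` is never constant at a
puncture (`pAt_ne_C`). -/
lemma comp_zero_eq_C (F : LaurentSeries ℂ) : ∃ c, comp F 0 = HahnSeries.C c := by
  have h : (PowerSeries.mk fun i : ℕ => (0 : LaurentSeries ℂ).coeff i) = 0 := by ext; simp
  rw [comp, h]
  by_cases hF : F.order = 0
  · refine ⟨constantCoeff F.powerSeriesPart, ?_⟩
    rw [hF, zpow_zero, one_mul, subst_zero_eq_C_constantCoeff, ← PowerSeries.coe_C]
    rfl
  · exact ⟨0, by rw [zero_zpow _ hF, zero_mul, map_zero]⟩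

lemma eq_coe_of_coeff_nonpos {w : LaurentSeries ℂ} (h : ∀ i ≤ 0, w.coeff i = 0) :
    ∃ W : PowerSeries ℂ, constantCoeff W = 0 ∧ w = (W : LaurentSeries ℂ) := by
  refine ⟨PowerSeries.mk fun i => w.coeff i, by simp [h], ?_⟩
  ext i
  rw [PowerSeries.coeff_coe]
  split_ifs with hi
  · exact h i hi.le
  · simp [abs_of_nonneg (not_lt.1 hi)]

lemma eq_coe_of_coeff_neg {w : LaurentSeries ℂ} (h : ∀ i < 0, w.coeff i = 0) :
    ∃ W : PowerSeries ℂ, w = (W : LaurentSeries ℂ) := by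
  refine ⟨PowerSeries.mk fun i => w.coeff i, ?_⟩
  ext i
  rw [PowerSeries.coeff_coe]
  split_ifs with hi
  · exact h i hi
  · simp [abs_of_nonneg (not_lt.1 hi)]

end Comp

/-! ## Functions of the slow variables -/

section SlowFunctions

variable {N : ℕ} {U : Set (Slow N)}
variable {E : Type*} [NormedAddCommGroup E] [NormedSpace ℝ E] [FiniteDimensional ℝ E]

lemma IsSlowOpen.isOpen (hU : IsSlowOpen U) (x : Slow N) (L : E →ₗ[ℝ] Slow N) :
    IsOpen {c | x + L c ∈ U} := by
  let e : E ≃L[ℝ] (Fin (Module.finrank ℝ E) → ℝ) := ContinuousLinearEquiv.ofFinrankEq (by simp)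
  have := (hU x _ (L.comp (e.symm : _ →L[ℝ] E).toLinearMap)).preimage e.continuous
  simpa using this

lemma IsSlowFunction.contDiffOn {g : Slow N → ℂ} (hg : IsSlowFunction U g) (x : Slow N)
    (L : E →ₗ[ℝ] Slow N) : ContDiffOn ℝ ∞ (fun c => g (x + L c)) {c | x + L c ∈ U} := by
  let e : E ≃L[ℝ] (Fin (Module.finrank ℝ E) → ℝ) := ContinuousLinearEquiv.ofFinrankEq (by simp)
  have := (hg.1 x _ (L.comp (e.symm : _ →L[ℝ] E).toLinearMap)).comp
    (e.contDiff (n := ∞)).contDiffOn (s := {c | x + L c ∈ U}) (fun c hc => by simpa using hc)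
  refine this.congr fun c hc => ?_
  simp

/-- The complex line of the time `t_{ja}`. -/
def timeLine (a : Idx N) (j : ℕ+) : ℂ →ₗ[ℝ] Slow N where
  toFun c := dirT a j c
  map_add' c d := by
    ext b k
    · simp [dirT]
    · by_cases h : b = a
      · subst h; simp [dirT]
      · simp [dirT, h]
  map_smul' r c := by
    ext b k
    · simp [dirT]
    · by_cases h : b = a
      · subst h; simp [dirT]
      · simp [dirT, h]

@[simp] lemma timeLine_apply (a : Idx N) (j : ℕ+) (c : ℂ) : timeLine a j c = dirT a j c := rfl

lemma dirT_zero (a : Idx N) (j : ℕ+) : dirT a j 0 = 0 := (timeLine a j).map_zero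

lemma dirT_add (a : Idx N) (j : ℕ+) (c d : ℂ) : dirT a j (c + d) = dirT a j c + dirT a j d :=
  (timeLine a j).map_add c d

lemma dirT_ofReal (a : Idx N) (j : ℕ+) (r : ℝ) : dirT a j (r : ℂ) = r • dirT a j 1 := by
  simpa using (timeLine a j).map_smul r 1

lemma dirS_swap (a b : Idx N) : dirS b a = -dirS a b := by
  ext <;> simp [dirS]

lemma IsSlowOpen.eventually_dirT (hU : IsSlowOpen U) {x : Slow N} (hx : x ∈ U) (a : Idx N)
    (j : ℕ+) : ∀ᶠ τ : ℂ in 𝓝 0, x + dirT a j τ ∈ U :=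
  (hU.isOpen x (timeLine a j)).mem_nhds (by simpa [dirT_zero] using hx)

lemma IsSlowOpen.eventually_smul (hU : IsSlowOpen U) {x : Slow N} (hx : x ∈ U) (v : Slow N) :
    ∀ᶠ τ : ℝ in 𝓝 0, x + τ • v ∈ U :=
  (hU.isOpen x (LinearMap.toSpanSingleton ℝ _ v)).mem_nhds (by simpa using hx)

lemma IsSlowFunction.congr (hU : IsSlowOpen U) {g h : Slow N → ℂ} (hg : IsSlowFunction U g)
    (e : ∀ x ∈ U, h x = g x) : IsSlowFunction U h := by
  refine ⟨fun x d L => (hg.1 x d L).congr fun c hc => e _ hc, fun x hx a j => ?_⟩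
  refine (hg.2 x hx a j).congr_of_eventuallyEq ?_
  filter_upwards [hU.eventually_dirT hx a j] with τ hτ using e _ hτ

lemma isSlowFunction_const (c : ℂ) : IsSlowFunction U fun _ => c :=
  ⟨fun _ _ _ => contDiffOn_const, fun _ _ _ _ => differentiableAt_const _⟩

lemma IsSlowFunction.add {g h : Slow N → ℂ} (hg : IsSlowFunction U g) (hh : IsSlowFunction U h) :
    IsSlowFunction U fun x => g x + h x :=
  ⟨fun x d L => (hg.1 x d L).add (hh.1 x d L), fun x hx a j => (hg.2 x hx a j).add (hh.2 x hx a j)⟩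

lemma IsSlowFunction.mul {g h : Slow N → ℂ} (hg : IsSlowFunction U g) (hh : IsSlowFunction U h) :
    IsSlowFunction U fun x => g x * h x :=
  ⟨fun x d L => (hg.1 x d L).mul (hh.1 x d L), fun x hx a j => (hg.2 x hx a j).mul (hh.2 x hx a j)⟩

lemma IsSlowFunction.neg {g : Slow N → ℂ} (hg : IsSlowFunction U g) :
    IsSlowFunction U fun x => -g x :=
  ⟨fun x d L => (hg.1 x d L).neg, fun x hx a j => (hg.2 x hx a j).neg⟩

lemma IsSlowFunction.inv {g : Slow N → ℂ} (hg : IsSlowFunction U g) (h : ∀ x ∈ U, g x ≠ 0) :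
    IsSlowFunction U fun x => (g x)⁻¹ :=
  ⟨fun x d L => (hg.1 x d L).inv fun _ hc => h _ hc,
    fun x hx a j => (hg.2 x hx a j).inv (by simpa [dirT_zero] using h x hx)⟩

/-- The derivative in a direction of the space of slow variables. -/
def slowDeriv (v : Slow N) (g : Slow N → ℂ) (x : Slow N) : ℂ :=
  deriv (fun τ : ℝ => g (x + τ • v)) 0

lemma IsSlowFunction.hasDerivAt_line (hU : IsSlowOpen U) {g : Slow N → ℂ} (hg : IsSlowFunction U g)
    (x v : Slow N) {τ : ℝ} (hx : x + τ • v ∈ U) :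
    HasDerivAt (fun τ : ℝ => g (x + τ • v)) (slowDeriv v g (x + τ • v)) τ := by
  have h0 : ∀ {y : Slow N}, y ∈ U →
      HasDerivAt (fun τ : ℝ => g (y + τ • v)) (slowDeriv v g y) 0 := by
    intro y hy
    have h1 := hg.contDiffOn y (LinearMap.toSpanSingleton ℝ _ v)
    have h2 := (h1.contDiffAt ((hU.isOpen y (LinearMap.toSpanSingleton ℝ _ v)).mem_nhds
      (by simpa using hy : (0 : ℝ) ∈ _))).differentiableAt (by simp)
    exact h2.hasDerivAt
  have h3 := HasDerivAt.comp_sub_const (x := τ) (a := τ)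
    (f := fun σ : ℝ => g (x + τ • v + σ • v)) (by rw [sub_self]; exact h0 hx)
  refine h3.congr_of_eventuallyEq (Filter.Eventually.of_forall fun σ => ?_)
  have : x + σ • v = x + τ • v + (σ - τ) • v := by module
  simp only [this]

/-- By holomorphy the complex time derivative is the real derivative in the direction `dirT a j 1`,
so `slowDeriv` serves charges and times alike. -/
lemma IsSlowFunction.hasDerivAt_time {g : Slow N → ℂ} (hU : IsSlowOpen U)
    (hg : IsSlowFunction U g) {x : Slow N} (hx : x ∈ U) (a : Idx N) (j : ℕ+) :
    HasDerivAt (fun τ : ℂ => g (x + dirT a j τ)) (slowDeriv (dirT a j 1) g x) 0 := by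
  have h1 := (hg.2 x hx a j).hasDerivAt
  have h2 := HasDerivAt.comp_ofReal (z := 0) (by rw [Complex.ofReal_zero]; exact h1)
  have h3 := hg.hasDerivAt_line hU x (dirT a j 1) (τ := 0) (by simpa using hx)
  simp only [dirT_ofReal] at h2
  rw [h2.unique h3, zero_smul, add_zero] at h1
  exact h1

/-- Smoothness: the direction `v` is adjoined as one more coordinate. Holomorphy: the Cauchy–Riemann
equation in the time plane can be differentiated along `v`, by symmetry of the second derivative. -/
lemma IsSlowFunction.slowDeriv (hU : IsSlowOpen U) {g : Slow N → ℂ} (hg : IsSlowFunction U g)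
    (v : Slow N) : IsSlowFunction U (slowDeriv v g) := by
  constructor
  · intro x d L
    let L' : (Fin d → ℝ) × ℝ →ₗ[ℝ] Slow N := L.coprod (LinearMap.toSpanSingleton ℝ _ v)
    have hG := hg.contDiffOn x L'
    have hO := hU.isOpen x L'
    have h1 : ContDiffOn ℝ ∞ (fun p => fderiv ℝ (fun c => g (x + L' c)) p (0, 1))
        {c | x + L' c ∈ U} := (hG.fderiv_of_isOpen hO (by simp)).clm_apply contDiffOn_const
    have h2 : ContDiffOn ℝ ∞ (fun c : Fin d → ℝ => (c, (0 : ℝ))) {c | x + L c ∈ U} :=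
      (contDiff_id.prodMk contDiff_const).contDiffOn
    refine (h1.comp h2 (fun c hc => by simpa [L'] using hc)).congr fun c hc => ?_
    have hc' : (c, (0 : ℝ)) ∈ {c | x + L' c ∈ U} := by simpa [L'] using hc
    have h3 := ((hG.contDiffAt (hO.mem_nhds hc')).differentiableAt (by simp)).hasFDerivAt
    have h4 : HasDerivAt (fun τ : ℝ => (c, τ)) (0, 1) 0 :=
      (hasDerivAt_const _ _).prodMk (hasDerivAt_id _)
    have h5 := h3.comp_hasDerivAt (0 : ℝ) h4
    refine Eq.trans ?_ h5.deriv
    simp [WhithamKP.slowDeriv, L', Function.comp_def, add_assoc]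
  · intro x hx a j
    let L' : ℂ × ℝ →ₗ[ℝ] Slow N := (timeLine a j).coprod (LinearMap.toSpanSingleton ℝ _ v)
    let G : ℂ × ℝ → ℂ := fun c => g (x + L' c)
    have hG : ContDiffOn ℝ ∞ G _ := hg.contDiffOn x L'
    have hO := hU.isOpen x L'
    have h0 : (0 : ℂ × ℝ) ∈ {c | x + L' c ∈ U} := by simpa using hx
    have hdiff : ∀ p ∈ {c | x + L' c ∈ U}, DifferentiableAt ℝ G p := fun p hp =>
      (hG.contDiffAt (hO.mem_nhds hp)).differentiableAt (by simp)
    -- Cauchy–Riemann is needed at all nearby points, since it will be differentiated along `v`;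
    -- holomorphy at the base point is transported to `p` by translation.
    have hCR : ∀ p ∈ {c | x + L' c ∈ U},
        fderiv ℝ G p (Complex.I, 0) = Complex.I * fderiv ℝ G p (1, 0) := by
      intro p hp
      have h1 : DifferentiableAt ℂ (fun c : ℂ => G (c, p.2)) p.1 := by
        have h2 := (hg.2 _ hp a j).hasDerivAt
        have h3 := HasDerivAt.comp_sub_const (x := p.1) (a := p.1)
          (f := fun σ : ℂ => g (x + L' p + dirT a j σ)) (by rw [sub_self]; exact h2)
        refine (h3.congr_of_eventuallyEq (Filter.Eventually.of_forall fun σ => ?_)).differentiableAt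
        have : dirT a j σ = dirT a j p.1 + dirT a j (σ - p.1) := by
          rw [← dirT_add, add_sub_cancel]
        simp only [G, L', LinearMap.coprod_apply, timeLine_apply, this]
        congr 1
        abel
      have h4 := differentiableAt_complex_iff_differentiableAt_real.1 h1
      have h5 : HasFDerivAt (fun c : ℂ => G (c, p.2))
          ((fderiv ℝ G p).comp (ContinuousLinearMap.inl ℝ ℂ ℝ)) p.1 :=
        HasFDerivAt.comp (g := G) p.1 (hdiff p hp).hasFDerivAt (hasFDerivAt_prodMk_left p.1 p.2)
      have h6 := h4.2
      rw [h5.fderiv] at h6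
      simpa using h6
    have hk : (fun τ : ℂ => WhithamKP.slowDeriv v g (x + dirT a j τ)) =ᶠ[𝓝 0]
        fun τ => fderiv ℝ G (τ, 0) (0, 1) := by
      filter_upwards [hU.eventually_dirT hx a j] with τ hτ
      have h3 := (hdiff (τ, 0) (by simpa [L'] using hτ)).hasFDerivAt
      have h4 : HasDerivAt (fun r : ℝ => (τ, r)) (0, 1) 0 :=
        (hasDerivAt_const _ _).prodMk (hasDerivAt_id _)
      refine Eq.trans ?_ (h3.comp_hasDerivAt (0 : ℝ) h4).deriv
      simp [WhithamKP.slowDeriv, L', G, Function.comp_def, add_assoc]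
    refine DifferentiableAt.congr_of_eventuallyEq ?_ hk
    have hD : DifferentiableAt ℝ (fderiv ℝ G) 0 :=
      ((hG.fderiv_of_isOpen (m := ∞) hO (by simp)).contDiffAt (hO.mem_nhds h0)).differentiableAt
        (by simp)
    have hsymm : IsSymmSndFDerivAt ℝ G 0 :=
      (hG.contDiffAt (hO.mem_nhds h0)).isSymmSndFDerivAt (by
        rw [minSmoothness_of_isRCLikeNormedField]
        exact WithTop.coe_le_coe.2 (le_top : (2 : ℕ∞) ≤ ⊤))
    have hB : HasFDerivAt (fun τ : ℂ => fderiv ℝ G (τ, 0) (0, 1))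
        (((fderiv ℝ (fderiv ℝ G) 0).flip (0, 1)).comp (ContinuousLinearMap.inl ℝ ℂ ℝ)) 0 := by
      have h1 : HasFDerivAt (fun p => fderiv ℝ G p (0, 1))
          ((fderiv ℝ (fderiv ℝ G) 0).flip (0, 1)) ((0 : ℂ), (0 : ℝ)) := by
        have := hD.hasFDerivAt.clm_apply (hasFDerivAt_const ((0 : ℂ), (1 : ℝ)) 0)
        simp only [ContinuousLinearMap.comp_zero, zero_add] at this
        exact this
      exact HasFDerivAt.comp (𝕜 := ℝ) (f := fun τ : ℂ => (τ, (0 : ℝ))) (0 : ℂ) h1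
        (hasFDerivAt_prodMk_left (0 : ℂ) (0 : ℝ))
    refine differentiableAt_complex_iff_differentiableAt_real.2 ⟨hB.differentiableAt, ?_⟩
    have hC : ∀ u : ℂ, fderiv ℝ (fderiv ℝ G) 0 (0, 1) (u, 0) =
        fderiv ℝ (fun p => fderiv ℝ G p (u, 0)) 0 (0, 1) := by
      intro u
      have := (hD.hasFDerivAt.clm_apply (hasFDerivAt_const (u, (0 : ℝ)) 0)).fderiv
      rw [this]
      simp
    rw [hB.fderiv]
    simp only [ContinuousLinearMap.comp_apply, ContinuousLinearMap.inl_apply,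
      ContinuousLinearMap.flip_apply, smul_eq_mul]
    -- With the two derivatives exchanged, the claim is the derivative of `hCR` along `v`.
    rw [hsymm, hsymm (1, 0), hC, hC]
    have hE : (fun p => fderiv ℝ G p (Complex.I, 0)) =ᶠ[𝓝 0]
        fun p => Complex.I • fderiv ℝ G p (1, 0) := by
      filter_upwards [hO.mem_nhds h0] with p hp using hCR p hp
    rw [hE.fderiv_eq, fderiv_fun_const_smul (hD.clm_apply (differentiableAt_const _))]
    simp

end SlowFunctions

/-! ## Power series with slow coefficients -/

section SlowSeries

variable {N : ℕ} {U : Set (Slow N)}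

/-- The ring of the restrictions to `U` of slow functions. -/
def slowRing (_ : IsSlowOpen U) : Subring (U → ℂ) where
  carrier := {φ | ∃ g, IsSlowFunction U g ∧ ∀ x : U, φ x = g x}
  mul_mem' := by
    rintro _ _ ⟨g, hg, eg⟩ ⟨h, hh, eh⟩
    exact ⟨_, hg.mul hh, fun x => by simp [eg, eh]⟩
  add_mem' := by
    rintro _ _ ⟨g, hg, eg⟩ ⟨h, hh, eh⟩
    exact ⟨_, hg.add hh, fun x => by simp [eg, eh]⟩
  neg_mem' := by
    rintro _ ⟨g, hg, eg⟩
    exact ⟨_, hg.neg, fun x => by simp [eg]⟩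
  zero_mem' := ⟨_, isSlowFunction_const 0, fun x => by simp⟩
  one_mem' := ⟨_, isSlowFunction_const 1, fun x => by simp⟩

/-- Evaluation at a point of `U`. -/
def slowEval (hU : IsSlowOpen U) (x : U) : slowRing hU →+* ℂ :=
  (Pi.evalRingHom (fun _ : U => ℂ) x).comp (slowRing hU).subtype

/-- A family of series with slow coefficients is a single power series over `slowRing`. Inverses and
compositional inverses formed over that ring automatically have slow coefficients. -/
lemma exists_slow_lift (hU : IsSlowOpen U) {G : Slow N → PowerSeries ℂ}
    (hG : ∀ i, IsSlowFunction U fun x => PowerSeries.coeff i (G x)) :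
    ∃ P : PowerSeries (slowRing hU), ∀ x : U, P.map (slowEval hU x) = G x :=
  ⟨PowerSeries.mk fun i => ⟨fun x => PowerSeries.coeff i (G x), _, hG i, fun _ => rfl⟩,
    fun x => by ext i; simp [slowEval]⟩

lemma exists_slow_coeff (hU : IsSlowOpen U) (P : PowerSeries (slowRing hU)) :
    ∃ G : Slow N → PowerSeries ℂ, (∀ i, IsSlowFunction U fun x => PowerSeries.coeff i (G x)) ∧
      ∀ x : U, P.map (slowEval hU x) = G x := by
  choose g hg e using fun i => (PowerSeries.coeff i P).2
  exact ⟨fun x => PowerSeries.mk fun i => g i x, fun i => by simpa using hg i,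
    fun x => by ext i; simpa [slowEval] using e i x⟩

lemma isUnit_slowRing (hU : IsSlowOpen U) (φ : slowRing hU) (h : ∀ x, slowEval hU x φ ≠ 0) :
    IsUnit φ := by
  obtain ⟨φ, g, hg, e⟩ := φ
  have h' : ∀ x : U, φ x ≠ 0 := h
  refine IsUnit.of_mul_eq_one ⟨fun x => (φ x)⁻¹, _, hg.inv fun x hx => ?_, fun x => by simp only [e]⟩ ?_
  · rw [← e ⟨x, hx⟩]; exact h' _
  · ext x
    simp [h' x]

lemma exists_slow_inv (hU : IsSlowOpen U) {G : Slow N → PowerSeries ℂ}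
    (hG : ∀ i, IsSlowFunction U fun x => PowerSeries.coeff i (G x))
    (h0 : ∀ x ∈ U, PowerSeries.constantCoeff (G x) ≠ 0) :
    ∃ H : Slow N → PowerSeries ℂ, (∀ i, IsSlowFunction U fun x => PowerSeries.coeff i (H x)) ∧
      ∀ x ∈ U, G x * H x = 1 := by
  obtain ⟨P, hP⟩ := exists_slow_lift hU hG
  have hu : IsUnit P := PowerSeries.isUnit_iff_constantCoeff.2 (isUnit_slowRing hU _ fun x => by
    have := h0 x x.2
    rw [← hP x, ← PowerSeries.coeff_zero_eq_constantCoeff_apply, PowerSeries.coeff_map] at this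
    simpa using this)
  obtain ⟨Q, hQ⟩ := hu.exists_right_inv
  obtain ⟨H, hH, e⟩ := exists_slow_coeff hU Q
  refine ⟨H, hH, fun x hx => ?_⟩
  rw [← e ⟨x, hx⟩, ← hP ⟨x, hx⟩, ← map_mul, hQ, map_one]

lemma exists_slow_substInv (hU : IsSlowOpen U) {G : Slow N → PowerSeries ℂ}
    (hG : ∀ i, IsSlowFunction U fun x => PowerSeries.coeff i (G x))
    (h0 : ∀ x ∈ U, PowerSeries.constantCoeff (G x) = 0)
    (h1 : ∀ x ∈ U, PowerSeries.coeff 1 (G x) ≠ 0) :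
    ∃ H : Slow N → PowerSeries ℂ, (∀ i, IsSlowFunction U fun x => PowerSeries.coeff i (H x)) ∧
      ∀ x ∈ U, PowerSeries.constantCoeff (H x) = 0 ∧ (G x).subst (H x) = PowerSeries.X ∧
        (H x).subst (G x) = PowerSeries.X := by
  obtain ⟨P, hP⟩ := exists_slow_lift hU hG
  have hu : IsUnit (PowerSeries.coeff 1 P) := isUnit_slowRing hU _ fun x => by
    have := h1 x x.2
    rw [← hP x] at this
    simpa using this
  have hP0 : PowerSeries.constantCoeff P = 0 := by
    ext x
    have := h0 x x.2
    rw [← hP x, ← PowerSeries.coeff_zero_eq_constantCoeff_apply, PowerSeries.coeff_map] at this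
    simpa [slowEval] using this
  obtain ⟨H, hH, e⟩ := exists_slow_coeff hU (P.substInvOfIsUnit hu)
  have hs : PowerSeries.HasSubst (P.substInvOfIsUnit hu) := PowerSeries.HasSubst.substInvOfIsUnit P hu
  have hs' : PowerSeries.HasSubst P := PowerSeries.HasSubst.of_constantCoeff_zero' hP0
  refine ⟨H, hH, fun x hx => ⟨?_, ?_, ?_⟩⟩
  · rw [← e ⟨x, hx⟩, ← PowerSeries.coeff_zero_eq_constantCoeff_apply, PowerSeries.coeff_map]
    simp
  · rw [← e ⟨x, hx⟩, ← hP ⟨x, hx⟩]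
    have := PowerSeries.map_subst hs (h := slowEval hU ⟨x, hx⟩) P
    rw [PowerSeries.subst_substInvOfIsUnit_right P hP0] at this
    refine this.symm.trans ?_
    exact PowerSeries.map_X _
  · rw [← e ⟨x, hx⟩, ← hP ⟨x, hx⟩]
    have := PowerSeries.map_subst hs' (h := slowEval hU ⟨x, hx⟩) (P.substInvOfIsUnit hu)
    rw [PowerSeries.subst_substInvOfIsUnit_left P hP0] at this
    refine this.symm.trans ?_
    exact PowerSeries.map_X _

end SlowSeries

/-! ## Rows of the dressing operators -/

section Rows

variable {N : ℕ}

/-- The row `r` at the site `n + i` of `Λⁱ` times the pair `(X, Xb)`; the entry `b m` is the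
coefficient of `w ^ m` at the puncture `b`. -/
def rowVec (X Xb : Op N) (n i : ℤ) (r : Fin N) : Idx N → ℤ → ℂ
  | Sum.inl c, m => X (-m - i) (n + i) r c
  | Sum.inr c, m => Xb (m - i) (n + i) r c

/-- The rows at the site `n` of all multiples of `(X, Xb)` by operators with finitely many powers
of `Λ`. -/
def rowSpan (X Xb : Op N) (n : ℤ) : Submodule ℂ (Idx N → ℤ → ℂ) :=
  Submodule.span ℂ (Set.range fun p : ℤ × Fin N => rowVec X Xb n p.1 p.2)

lemma rowVec_mem (X Xb : Op N) (n i : ℤ) (r : Fin N) : rowVec X Xb n i r ∈ rowSpan X Xb n :=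
  Submodule.subset_span ⟨(i, r), rfl⟩

/-- A term `b Λᵏ` of `B` moves layer `i` to layer `i + k`, with coefficients taken at the site `n +
i`; finiteness of `B` keeps the combination finite. -/
lemma rowVec_bandMul_mem (B : ℤ →₀ (ℤ → Matrix (Fin N) (Fin N) ℂ)) (X Xb : Op N) (n i : ℤ)
    (r : Fin N) : rowVec (bandMul B X) (bandMul B Xb) n i r ∈ rowSpan X Xb n := by
  have h : rowVec (bandMul B X) (bandMul B Xb) n i r =
      ∑ k ∈ B.support, ∑ r', B k (n + i) r r' • rowVec X Xb n (i + k) r' := by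
    ext b m
    cases b <;>
      simp [rowVec, bandMul, Finsupp.sum, Matrix.sum_apply, Matrix.mul_apply, Finset.sum_apply,
        sub_sub, add_assoc]
  rw [h]
  exact Submodule.sum_mem _ fun k _ => Submodule.sum_mem _ fun r' _ =>
    Submodule.smul_mem _ _ (rowVec_mem _ _ _ _ _)

lemma rowSpan_bandMul_le (B : ℤ →₀ (ℤ → Matrix (Fin N) (Fin N) ℂ)) (X Xb : Op N) (n : ℤ) :
    rowSpan (bandMul B X) (bandMul B Xb) n ≤ rowSpan X Xb n :=
  Submodule.span_le.2 fun _ ⟨_, h⟩ => h ▸ rowVec_bandMul_mem _ _ _ _ _ _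

/-- Multiplication by `w ^ (-D b)` at the puncture `b`. -/
def chargeShift (D : Idx N → ℤ) : (Idx N → ℤ → ℂ) →ₗ[ℂ] (Idx N → ℤ → ℂ) where
  toFun v b m := v b (m + D b)
  map_add' _ _ := rfl
  map_smul' _ _ := rfl

/-- Right multiplication by powers of `Λ` acts on columns and commutes with taking rows. The
opposite signs come from `w = z⁻¹` on the left factor and `w = z` on the right one. -/
lemma rowSpan_mulShift (X Xb : Op N) (D : Idx N → ℤ) (n : ℤ) :
    rowSpan (mulShift X fun k => D (Sum.inl k)) (mulShift Xb fun k => -D (Sum.inr k)) n =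
      (rowSpan X Xb n).map (chargeShift D) := by
  rw [rowSpan, rowSpan, Submodule.map_span, ← Set.range_comp]
  congr 2
  funext p
  ext b m
  cases b
  · simp only [rowVec, mulShift, Matrix.of_apply, Function.comp_apply, chargeShift,
      LinearMap.coe_mk, AddHom.coe_mk]
    congr 1
    ring_nf
  · simp only [rowVec, mulShift, Matrix.of_apply, Function.comp_apply, chargeShift,
      LinearMap.coe_mk, AddHom.coe_mk]
    congr 1
    ring_nf

lemma sum_eq_sum_layer {s : Finset (ℤ × Fin N)} {t : ℤ × Fin N → ℂ} (i : ℤ)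
    (h1 : ∀ p ∈ s, p.1 ≠ i → t p = 0) (h2 : ∀ p ∉ s, t p = 0) :
    ∑ p ∈ s, t p = ∑ r, t (i, r) := by
  classical
  rw [← Finset.sum_image (s := Finset.univ) (g := fun r : Fin N => (i, r)) (f := t)
    (fun r _ r' _ h => (Prod.mk.inj h).2)]
  refine Finset.sum_congr_of_eq_on_inter (fun p hp hp' => h1 p hp fun h => hp' ?_)
    (fun p _ hp' => h2 p hp') (fun _ _ _ => rfl)
  exact Finset.mem_image.2 ⟨p.2, Finset.mem_univ _, by rw [← h]⟩

/-- A row which is regular in `Λ⁻¹`, without constant term, on the left factor, and regular in `Λ`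
on the right factor vanishes. -/
lemma eq_zero_of_mem_rowSpan {X Xb : Op N} {n : ℤ}
    (hX : ∀ n, X 0 n = 1 ∧ ∀ m, 0 < m → X m n = 0)
    (hXb : ∀ n, IsUnit (Xb 0 n) ∧ ∀ m, m < 0 → Xb m n = 0)
    {v : Idx N → ℤ → ℂ} (hv : v ∈ rowSpan X Xb n)
    (h1 : ∀ c, ∀ m ≤ 0, v (Sum.inl c) m = 0) (h2 : ∀ c, ∀ m < 0, v (Sum.inr c) m = 0) :
    v = 0 := by
  obtain ⟨α, rfl⟩ := (Finsupp.mem_span_range_iff_exists_finsupp).1 hv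
  simp only [Finsupp.sum, Finset.sum_apply, Pi.smul_apply, smul_eq_mul, rowVec] at h1 h2
  suffices hα : α.support = ∅ by simp [Finsupp.sum, hα]
  by_contra hne
  rw [← Ne, ← Finset.nonempty_iff_ne_empty] at hne
  obtain ⟨p, hp, hmax⟩ := Finset.exists_max_image α.support Prod.fst hne
  obtain ⟨q, hq, hmin⟩ := Finset.exists_min_image α.support Prod.fst hne
  -- Were the top layer `i` non-negative, it alone would give the coefficient of `Λⁱ` on the left
  -- factor, through the leading coefficient 1, against `h1`.
  have hp0 : p.1 < 0 := by
    by_contra hp0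
    have h := h1 p.2 (-p.1) (by omega)
    rw [sum_eq_sum_layer p.1] at h
    · simp only [neg_neg, sub_self, (hX _).1, Matrix.one_apply, mul_ite, mul_one, mul_zero,
        Finset.sum_ite_eq', Finset.mem_univ, if_true] at h
      exact Finsupp.mem_support_iff.1 hp h
    · intro p' hp' hne'
      rw [(hX _).2 _ (by have := lt_of_le_of_ne (hmax p' hp') hne'; omega)]
      simp
    · intro p' hp'
      rw [Finsupp.notMem_support_iff.1 hp', zero_mul]
  have hq0 : q.1 < 0 := (hmin p hp).trans_lt hp0
  -- All layers are negative, and the lowest one alone gives the coefficient of `Λ ^ q.1` on the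
  -- right factor, through the invertible leading coefficient of `Xb`.
  have h : Matrix.vecMul (fun r => α (q.1, r)) (Xb 0 (n + q.1)) = 0 := by
    ext c
    have h := h2 c q.1 hq0
    rw [sum_eq_sum_layer q.1] at h
    · simpa [Matrix.vecMul, dotProduct] using h
    · intro p' hp' hne'
      rw [(hXb _).2 _ (by have := lt_of_le_of_ne' (hmin p' hp') hne'; omega)]
      simp
    · intro p' hp'
      rw [Finsupp.notMem_support_iff.1 hp', zero_mul]
  have h' : (fun r => α (q.1, r)) = 0 :=
    Matrix.vecMul_injective_iff_isUnit.2 (hXb (n + q.1)).1 (h.trans (Matrix.zero_vecMul _).symm)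
  exact Finsupp.mem_support_iff.1 hq (congrFun h' q.2)

/-- The exponent by which the first row is shifted in `waveSeries`. -/
def offset [NeZero N] : Idx N → ℤ
  | Sum.inl k => if k = 0 then 0 else 1
  | Sum.inr _ => 0

lemma mul_smul_laurent (c : ℂ) (F G : LaurentSeries ℂ) : F * c • G = c • (F * G) := by
  rw [← HahnSeries.C_mul_eq_smul, ← HahnSeries.C_mul_eq_smul, mul_left_comm]

lemma coeff_single_mul' (k m : ℤ) (F : LaurentSeries ℂ) :
    (HahnSeries.single k (1 : ℂ) * F).coeff m = F.coeff (m - k) := by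
  have := HahnSeries.coeff_single_mul_add (r := (1 : ℂ)) (x := F) (a := m - k) (b := k)
  simpa using this

/-- The factor `w ^ offset b` undoes the index shift of `waveSeries`: off-diagonal entries of the
first row of `S` start at `Λ⁻¹`. The hypotheses cover the exponents outside the range of the series.
-/
lemma coeff_offset_mul_waveSeries [NeZero N] {X Xb : Op N} {n : ℤ}
    (h1 : ∀ m c, 0 < m → X m n 0 c = 0) (h2 : ∀ c, c ≠ 0 → X 0 n 0 c = 0)
    (h3 : ∀ m c, m < 0 → Xb m n 0 c = 0) (b : Idx N) (m : ℤ) :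
    (HahnSeries.single (offset b) (1 : ℂ) * (waveSeries X Xb n b : LaurentSeries ℂ)).coeff m =
      rowVec X Xb n 0 0 b m := by
  rw [coeff_single_mul', PowerSeries.coeff_coe]
  cases b with
  | inl k =>
    by_cases hk : k = 0
    · subst hk
      simp only [offset, if_true, sub_zero, waveSeries, PowerSeries.coeff_mk, rowVec, add_zero]
      split_ifs with hm
      · rw [h1 _ _ (by omega)]
      · rw [Int.natCast_natAbs, abs_of_nonneg (by omega)]
    · simp only [offset, hk, if_false, sub_zero, waveSeries, PowerSeries.coeff_mk, rowVec, add_zero]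
      split_ifs with hm
      · rcases (show m ≤ 0 by omega).lt_or_eq with hm | rfl
        · rw [h1 _ _ (by omega)]
        · rw [neg_zero, h2 _ hk]
      · rw [Int.natCast_natAbs, abs_of_nonneg (by omega), sub_add_cancel]
  | inr k =>
    simp only [offset, sub_zero, waveSeries, PowerSeries.coeff_mk, rowVec, add_zero]
    split_ifs with hm
    · rw [h3 _ _ hm]
    · rw [Int.natCast_natAbs, abs_of_nonneg (by omega)]

/-- Multiplication by the first row of the wave functions. -/
def rowMap [NeZero N] (X Xb : Op N) (n : ℤ) :
    (Idx N → LaurentSeries ℂ) →ₗ[ℂ] (Idx N → ℤ → ℂ) where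
  toFun Q b m := (HahnSeries.single (offset b) (1 : ℂ) *
    ((waveSeries X Xb n b : LaurentSeries ℂ) * Q b)).coeff m
  map_add' Q R := by
    ext b m
    simp [mul_add]
  map_smul' c Q := by
    ext b m
    simp [mul_smul_laurent]

/-- The quotients of rows in `rowSpan` by the first row of the wave functions. -/
def quotMod [NeZero N] (X Xb : Op N) (n : ℤ) : Submodule ℂ (Idx N → LaurentSeries ℂ) :=
  (rowSpan X Xb n).comap (rowMap X Xb n)

lemma eq_zero_of_mem_quotMod [NeZero N] {X Xb : Op N} {n : ℤ}
    (hX : ∀ n, X 0 n = 1 ∧ ∀ m, 0 < m → X m n = 0)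
    (hXb : ∀ n, IsUnit (Xb 0 n) ∧ ∀ m, m < 0 → Xb m n = 0)
    (hw : ∀ b, waveSeries X Xb n b ≠ 0)
    {Q : Idx N → LaurentSeries ℂ} (hQ : Q ∈ quotMod X Xb n)
    (h1 : ∀ b, ∀ m < 0, (Q b).coeff m = 0) (h2 : (Q one).coeff 0 = 0) : Q = 0 := by
  have hv : ∀ b, ∀ m < offset b, rowMap X Xb n Q b m = 0 := by
    intro b m hm
    obtain ⟨G, hG⟩ := eq_coe_of_coeff_neg (h1 b)
    simp only [rowMap, LinearMap.coe_mk, AddHom.coe_mk]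
    rw [hG, ← PowerSeries.coe_mul, coeff_single_mul', PowerSeries.coeff_coe, if_pos (by omega)]
  have hv0 : rowMap X Xb n Q (Sum.inl 0) 0 = 0 := by
    obtain ⟨G, hG, hG'⟩ := eq_coe_of_coeff_nonpos (w := Q one) (fun i hi => by
      rcases hi.lt_or_eq with hi | rfl
      exacts [h1 _ i hi, h2])
    simp only [rowMap, LinearMap.coe_mk, AddHom.coe_mk]
    rw [← one, hG', ← PowerSeries.coe_mul, coeff_single_mul', PowerSeries.coeff_coe]
    simp [one, offset, hG]
  have hz : rowMap X Xb n Q = 0 := by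
    refine eq_zero_of_mem_rowSpan hX hXb hQ (fun c m hm => ?_) fun c m hm => hv _ _ hm
    by_cases hc : c = 0
    · subst hc
      rcases hm.lt_or_eq with hm | rfl
      · exact hv _ _ (by simpa [offset] using hm)
      · exact hv0
    · exact hv _ _ (by simp only [offset, hc, if_false]; omega)
  funext b
  have hb : HahnSeries.single (offset b) (1 : ℂ) *
      ((waveSeries X Xb n b : LaurentSeries ℂ) * Q b) = 0 := by
    ext m
    exact congrFun (congrFun hz b) m
  have h3 : (HahnSeries.single (offset b) (1 : ℂ) : LaurentSeries ℂ) ≠ 0 := by simp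
  have h4 : (waveSeries X Xb n b : LaurentSeries ℂ) ≠ 0 := fun h =>
    hw b (HahnSeries.ofPowerSeries_injective (Γ := ℤ) (by simpa using h))
  exact (mul_eq_zero.1 ((mul_eq_zero.1 hb).resolve_left h3)).resolve_left h4

end Rows

/-! ## Quotients of wave functions -/

section Quotients

variable {N : ℕ} [NeZero N] {ε : ℝ} {U : Set (Slow N)} {S Sb : Slow N → Op N} {n : ℤ}

/-- The charges of the direction `dirS a b`. -/
def dirZ {N : ℕ} (a b c : Idx N) : ℤ := (if c = a then 1 else 0) - (if c = b then 1 else 0)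

lemma IsTodaSolution.coeff_row (hT : IsTodaSolution ε U S Sb) {x : Slow N} (hx : x ∈ U)
    (b : Idx N) (m : ℤ) :
    (HahnSeries.single (offset b) (1 : ℂ) *
      (waveSeries (S x) (Sb x) n b : LaurentSeries ℂ)).coeff m =
      rowVec (S x) (Sb x) n 0 0 b m :=
  coeff_offset_mul_waveSeries (fun m c hm => by rw [(hT.lower x hx n).2 m hm]; rfl)
    (fun c hc => by rw [(hT.lower x hx n).1, Matrix.one_apply_ne' hc])
    (fun m c hm => by rw [(hT.upper x hx n).2 m hm]; rfl) b m

omit [NeZero N] in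
-- The one-step shift equation is iterated, so every intermediate point must lie in `U`. Each band
-- operator takes rows of the shifted solution into the row span of the preceding one.
lemma IsTodaSolution.map_chargeShift_le (hT : IsTodaSolution ε U S Sb) {x : Slow N} {a b : Idx N}
    (hab : a ≠ b) (k : ℕ) (hU : ∀ l ≤ k, x + ((l : ℝ) * ε) • dirS a b ∈ U) :
    (rowSpan (S (x + ((k : ℝ) * ε) • dirS a b)) (Sb (x + ((k : ℝ) * ε) • dirS a b)) n).map
      (chargeShift fun c => k * dirZ a b c) ≤ rowSpan (S x) (Sb x) n := by
  induction k with
  | zero =>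
    have : chargeShift (fun c : Idx N => ((0 : ℕ) : ℤ) * dirZ a b c) = LinearMap.id := by
      ext v b m; simp [chargeShift]
    rw [this]
    simp
  | succ k ih =>
    have h1 := hU k (by omega)
    have h2 := hU (k + 1) le_rfl
    have e : x + (((k + 1 : ℕ) : ℝ) * ε) • dirS a b =
        x + ((k : ℝ) * ε) • dirS a b + ε • dirS a b := by
      push_cast
      module
    rw [e] at h2 ⊢
    obtain ⟨B, hB1, hB2⟩ := hT.shift _ h1 a b hab h2
    have e1 : chargeShift (fun c : Idx N => ((k + 1 : ℕ) : ℤ) * dirZ a b c) =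
        (chargeShift fun c => (k : ℤ) * dirZ a b c) ∘ₗ chargeShift (dirZ a b) := by
      ext v b m
      simp [chargeShift, add_mul, add_assoc]
    rw [e1, Submodule.map_comp]
    refine le_trans (Submodule.map_mono ?_) (ih fun l hl => hU l (by omega))
    rw [← rowSpan_mulShift]
    have e2 : (fun k : Fin N => -dirZ a b (Sum.inr k)) = fun k =>
        (if Sum.inr k = b then 1 else 0) - (if Sum.inr k = a then 1 else 0) := by
      funext k
      simp [dirZ]
    rw [e2]
    exact hB1 ▸ hB2 ▸ rowSpan_bandMul_le B _ _ n

/-- The quotient of the shifted and the original wave functions. -/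
lemma IsTodaSolution.shift_mem (hT : IsTodaSolution ε U S Sb)
    {F : Idx N → Slow N → PowerSeries ℂ}
    (hF : ∀ x ∈ U, ∀ a, waveSeries (S x) (Sb x) n a = expSeries (F a x))
    {x : Slow N} {a b : Idx N} (hab : a ≠ b) (k : ℕ)
    (hU : ∀ l ≤ k, x + ((l : ℝ) * ε) • dirS a b ∈ U) :
    (fun c => HahnSeries.single (-(k * dirZ a b c)) (1 : ℂ) *
      (expSeries (F c (x + ((k : ℝ) * ε) • dirS a b) - F c x) : LaurentSeries ℂ)) ∈
      quotMod (S x) (Sb x) n := by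
  have hx : x ∈ U := by simpa using hU 0 (by omega)
  -- The first row of the shifted solution is the witness; its quotient by the original first row is
  -- the exponential of a difference of phases.
  refine hT.map_chargeShift_le hab k hU ⟨_, rowVec_mem _ _ n 0 0, ?_⟩
  ext c m
  simp only [chargeShift, rowMap, LinearMap.coe_mk, AddHom.coe_mk]
  rw [← hT.coeff_row (hU k le_rfl), hF _ hx, hF _ (hU k le_rfl), mul_left_comm _
    (HahnSeries.single (-(k * dirZ a b c)) (1 : ℂ)), ← PowerSeries.coe_mul, ← expSeries_add,
    add_sub_cancel, mul_left_comm,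
    coeff_single_mul' (-(k * dirZ a b c)), sub_neg_eq_add]

/-- The logarithmic time derivative of the wave functions. -/
lemma IsTodaSolution.time_mem (hT : IsTodaSolution ε U S Sb) (hU : IsSlowOpen U)
    {F : Idx N → Slow N → PowerSeries ℂ}
    (hF : ∀ x ∈ U, ∀ a, waveSeries (S x) (Sb x) n a = expSeries (F a x))
    (hreg : ∀ a i, IsSlowFunction U fun x => PowerSeries.coeff i (F a x))
    {x : Slow N} (hx : x ∈ U) (a : Idx N) (j : ℕ+) :
    (fun c => HahnSeries.single (-(j : ℤ)) (if c = a then (1 : ℂ) else 0) + (ε : ℂ) •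
      ((PowerSeries.mk fun i => slowDeriv (dirT a j 1) (fun x => PowerSeries.coeff i (F c x)) x :
        PowerSeries ℂ) : LaurentSeries ℂ)) ∈ quotMod (S x) (Sb x) n := by
  set g : Idx N → PowerSeries ℂ := fun c => PowerSeries.mk fun i =>
    slowDeriv (dirT a j 1) (fun x => PowerSeries.coeff i (F c x)) x with hg
  have hev := hU.eventually_dirT hx a j
  have key : ∀ dS dSb, HasOpTimeDeriv S a j x dS → HasOpTimeDeriv Sb a j x dSb →
      ∀ c m, (HahnSeries.single (offset c) (1 : ℂ) *
        ((expSeries (F c x) : LaurentSeries ℂ) * (g c : LaurentSeries ℂ))).coeff m =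
        rowVec dS dSb n 0 0 c m := by
    intro dS dSb hS hSb c m
    have h1 : waveSeries dS dSb n c = g c * expSeries (F c x) := by
      ext i
      have h2 := hasDerivAt_coeff_expSeries (G := fun τ => F c (x + dirT a j τ)) (g' := g c)
        (z := 0) (fun m => by simpa [hg] using (hreg c m).hasDerivAt_time hU hx a j) i
      simp only [dirT_zero, add_zero] at h2
      have h3 : (fun τ : ℂ => PowerSeries.coeff i (expSeries (F c (x + dirT a j τ)))) =ᶠ[𝓝 0]
          fun τ => PowerSeries.coeff i
            (waveSeries (S (x + dirT a j τ)) (Sb (x + dirT a j τ)) n c) := by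
        filter_upwards [hev] with τ hτ
        rw [hF _ hτ]
      have h4 := h2.congr_of_eventuallyEq h3.symm
      refine HasDerivAt.unique ?_ h4
      cases c with
      | inl k =>
        simp only [waveSeries, PowerSeries.coeff_mk]
        split_ifs with hk
        · exact hS _ _ _ _
        · exact hS _ _ _ _
      | inr k =>
        simp only [waveSeries, PowerSeries.coeff_mk]
        exact hSb _ _ _ _
    -- Coefficients that are constant near `x` have zero derivative, so the differentiated pair
    -- satisfies the support conditions of `coeff_offset_mul_waveSeries`.
    have hz : ∀ {φ : ℂ → ℂ} {d e : ℂ}, HasDerivAt φ d 0 → (∀ᶠ τ in 𝓝 0, φ τ = e) → d = 0 :=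
      fun h h' => h.unique ((hasDerivAt_const (0 : ℂ) _).congr_of_eventuallyEq h')
    rw [mul_comm (expSeries (F c x) : LaurentSeries ℂ), ← PowerSeries.coe_mul, ← h1]
    refine coeff_offset_mul_waveSeries (fun m c hm => ?_) (fun c hc => ?_) (fun m c hm => ?_) c m
    · refine hz (hS m n 0 c) (e := 0) ?_
      filter_upwards [hev] with τ hτ
      rw [(hT.lower _ hτ n).2 m hm]; rfl
    · refine hz (hS 0 n 0 c) (e := 0) ?_
      filter_upwards [hev] with τ hτ
      rw [(hT.lower _ hτ n).1, Matrix.one_apply_ne' hc]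
    · refine hz (hSb m n 0 c) (e := 0) ?_
      filter_upwards [hev] with τ hτ
      rw [(hT.upper _ hτ n).2 m hm]; rfl
  -- The explicit exponential in `W₀` or `W̄₀` contributes a factor `w⁻ʲ` at the puncture `a` only;
  -- it is the `mulUnit` term of the Toda equations.
  have hcoeff : ∀ dS dSb, HasOpTimeDeriv S a j x dS → HasOpTimeDeriv Sb a j x dSb → ∀ c m,
      rowMap (S x) (Sb x) n (fun c => HahnSeries.single (-(j : ℤ)) (if c = a then (1 : ℂ) else 0) +
        (ε : ℂ) • (g c : LaurentSeries ℂ)) c m =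
      (if c = a then rowVec (S x) (Sb x) n 0 0 c (m + j) else 0) +
        ε * rowVec dS dSb n 0 0 c m := by
    intro dS dSb hS hSb c m
    rw [← key dS dSb hS hSb c m, ← hT.coeff_row hx]
    simp only [rowMap, LinearMap.coe_mk, AddHom.coe_mk, hF x hx, mul_add, HahnSeries.coeff_add,
      mul_smul_laurent, HahnSeries.coeff_smul, smul_eq_mul]
    congr 1
    split_ifs with hc
    · rw [← mul_assoc, mul_comm, coeff_single_mul' (-(j : ℤ)), sub_neg_eq_add]
    · simp
  cases a with
  | inl k =>
    obtain ⟨B, dS, dSb, hS, hSb, hB1, hB2⟩ := hT.time_unbarred x hx k j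
    refine Submodule.mem_comap.2 ?_
    convert rowVec_bandMul_mem B (S x) (Sb x) n 0 0 using 1
    funext c m
    rw [hcoeff dS dSb hS hSb, ← hB1, ← hB2]
    cases c with
    | inl c =>
      by_cases hc : c = k
      · subst hc
        simp [rowVec, mulUnit, add_comm, sub_eq_add_neg]
      · simp [rowVec, mulUnit, hc]
    | inr c => simp [rowVec]
  | inr k =>
    obtain ⟨B, dS, dSb, hS, hSb, hB1, hB2⟩ := hT.time_barred x hx k j
    refine Submodule.mem_comap.2 ?_
    convert rowVec_bandMul_mem B (S x) (Sb x) n 0 0 using 1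
    funext c m
    rw [hcoeff dS dSb hS hSb, ← hB1, ← hB2]
    cases c with
    | inr c =>
      by_cases hc : c = k
      · subst hc
        simp [rowVec, mulUnit, add_comm]
      · simp [rowVec, mulUnit, hc]
    | inl c => simp [rowVec]

end Quotients

/-! ## The dispersionless limit -/

section Limits

open Filter

/-- Cramer's rule in the limit: nothing is known about the coefficients at finite `ε`, but
determinant times coefficients equals adjugate times data, and the latter converges. -/
lemma exists_limit_combination {ι β : Type*} [Fintype ι] [DecidableEq ι] {l : Filter ℝ} [NeBot l]
    {u : ℝ → β → ℂ} {u₀ : β → ℂ} {v : ℝ → ι → β → ℂ} {v₀ : ι → β → ℂ}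
    (hu : ∀ b, Tendsto (fun ε => u ε b) l (𝓝 (u₀ b)))
    (hv : ∀ i b, Tendsto (fun ε => v ε i b) l (𝓝 (v₀ i b))) (e : ι → β)
    (hdet : (Matrix.of fun k i => v₀ i (e k)).det ≠ 0)
    (hcomb : ∀ᶠ ε in l, ∃ c : ι → ℂ, ∀ b, u ε b = ∑ i, c i * v ε i b) :
    ∃ c : ι → ℂ, ∀ b, u₀ b = ∑ i, c i * v₀ i b := by
  let M : ℝ → Matrix ι ι ℂ := fun ε => Matrix.of fun k i => v ε i (e k)
  let M₀ : Matrix ι ι ℂ := Matrix.of fun k i => v₀ i (e k)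
  have hM : Tendsto M l (𝓝 M₀) :=
    tendsto_pi_nhds.2 fun k => tendsto_pi_nhds.2 fun i => hv i (e k)
  have hd : Tendsto (fun ε => (M ε).det) l (𝓝 M₀.det) :=
    (Continuous.matrix_det continuous_id).continuousAt.tendsto.comp hM
  have ha : Tendsto (fun ε => (M ε).adjugate) l (𝓝 M₀.adjugate) :=
    (Continuous.matrix_adjugate continuous_id).continuousAt.tendsto.comp hM
  have hc : ∀ i, Tendsto (fun ε => ∑ k, (M ε).adjugate i k * u ε (e k)) l
      (𝓝 (∑ k, M₀.adjugate i k * u₀ (e k))) := fun i =>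
    tendsto_finsetSum _ fun k _ =>
      ((tendsto_pi_nhds.1 (tendsto_pi_nhds.1 ha i)) k).mul (hu (e k))
  refine ⟨fun i => M₀.det⁻¹ * ∑ k, M₀.adjugate i k * u₀ (e k), fun b => ?_⟩
  have h1 : Tendsto (fun ε => (M ε).det * u ε b) l (𝓝 (M₀.det * u₀ b)) := hd.mul (hu b)
  have h2 : Tendsto (fun ε => ∑ i, (∑ k, (M ε).adjugate i k * u ε (e k)) * v ε i b) l
      (𝓝 (∑ i, (∑ k, M₀.adjugate i k * u₀ (e k)) * v₀ i b)) :=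
    tendsto_finsetSum _ fun i _ => (hc i).mul (hv i b)
  -- Multiplied by the determinant, the identity needs no invertibility of `M ε`; division takes
  -- place only in the limit.
  have h3 : (fun ε => (M ε).det * u ε b) =ᶠ[l]
      fun ε => ∑ i, (∑ k, (M ε).adjugate i k * u ε (e k)) * v ε i b := by
    filter_upwards [hcomb] with ε ⟨c, hc⟩
    have h4 : (fun k => u ε (e k)) = (M ε).mulVec c := by
      funext k
      rw [hc]
      exact Finset.sum_congr rfl fun i _ => mul_comm _ _
    have h5 : (M ε).adjugate.mulVec (fun k => u ε (e k)) = (M ε).det • c := by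
      rw [h4, Matrix.mulVec_mulVec, Matrix.adjugate_mul, Matrix.smul_mulVec, Matrix.one_mulVec]
    have h6 : ∀ i, ∑ k, (M ε).adjugate i k * u ε (e k) = (M ε).det * c i := fun i => congrFun h5 i
    simp only [h6, hc b, Finset.mul_sum, mul_assoc]
  have h7 := tendsto_nhds_unique (h1.congr' h3) h2
  simp only [mul_assoc, ← Finset.mul_sum]
  rw [← h7, inv_mul_cancel_left₀ hdet]

variable {N : ℕ} {U : Set (Slow N)}

/-- Rewrites a directional derivative as `fderiv` on an affine line, the form in which convergence
of derivatives is assumed. -/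
lemma IsSlowFunction.slowDeriv_line_eq (hU : IsSlowOpen U) {g : Slow N → ℂ}
    (hg : IsSlowFunction U g) (x v : Slow N) {τ : ℝ} (hx : x + τ • v ∈ U) :
    WhithamKP.slowDeriv v g (x + τ • v) =
      fderiv ℝ (fun c : Fin 1 → ℝ => g (x + (LinearMap.toSpanSingleton ℝ _ v ∘ₗ
        LinearMap.proj 0) c)) (fun _ => τ) (fun _ => 1) := by
  set L : (Fin 1 → ℝ) →ₗ[ℝ] Slow N := LinearMap.toSpanSingleton ℝ _ v ∘ₗ LinearMap.proj 0
  have h1 := (((hg.1 x 1 L).contDiffAt ((hU x 1 L).mem_nhds (x := fun _ => τ) hx)).differentiableAt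
    (by simp)).hasFDerivAt
  have h2 : HasDerivAt (fun (τ : ℝ) (_ : Fin 1) => τ) (fun _ => 1) τ :=
    hasDerivAt_pi.2 fun _ => hasDerivAt_id τ
  have h3 : HasDerivAt (fun τ : ℝ => g (x + τ • v)) _ τ :=
    HasFDerivAt.comp_hasDerivAt (f := fun (τ : ℝ) (_ : Fin 1) => τ) τ h1 h2
  exact (hg.hasDerivAt_line hU x v hx).unique h3

variable [NeZero N] {ε₀ : ℝ} {S Sb : ℝ → Slow N → Op N} {n : ℝ → ℤ}
  {f : Idx N → ℕ → ℝ → Slow N → ℂ} {f₀ : Idx N → ℕ → Slow N → ℂ}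

lemma eventually_mem_Ioo (hε₀ : 0 < ε₀) : ∀ᶠ ε in 𝓝[>] (0 : ℝ), ε ∈ Set.Ioo 0 ε₀ :=
  Ioo_mem_nhdsGT hε₀

/-- Locally uniform convergence and continuity of the limiting derivative give closeness to one
number on a whole segment. This uniformity handles shifts whose length depends on `ε`. -/
lemma IsQuasiclassical.slowDeriv_near (hf : IsQuasiclassical ε₀ U S Sb n f f₀) (hε₀ : 0 < ε₀)
    (hU : IsSlowOpen U) {x : Slow N} (hx : x ∈ U) (v : Slow N) (a : Idx N) (i : ℕ) {δ : ℝ}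
    (hδ : 0 < δ) :
    ∃ r : ℝ, 0 < r ∧ (∀ τ ∈ Set.Icc (-r) r, x + τ • v ∈ U) ∧ ∀ᶠ ε in 𝓝[>] (0 : ℝ),
      ∀ τ ∈ Set.Icc (-r) r,
        ‖slowDeriv v (f a i ε) (x + τ • v) - slowDeriv v (f₀ a i) x‖ ≤ δ := by
  let L : (Fin 1 → ℝ) →ₗ[ℝ] Slow N := LinearMap.toSpanSingleton ℝ _ v ∘ₗ LinearMap.proj 0
  have h0 : (fun _ => 0 : Fin 1 → ℝ) ∈ {c | x + L c ∈ U} := by simpa [L] using hx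
  obtain ⟨t, ht, hev⟩ := Metric.tendstoLocallyUniformlyOn_iff.1 (hf.limit_deriv a i x 1 L)
    (δ / 2) (half_pos hδ) _ h0
  rw [nhdsWithin_eq_nhds.2 ((hU x 1 L).mem_nhds h0)] at ht
  have hc : Continuous fun (τ : ℝ) (_ : Fin 1) => τ := continuous_pi fun _ => continuous_id
  have ht' : ∀ᶠ τ : ℝ in 𝓝 0, (fun _ => τ : Fin 1 → ℝ) ∈ t := hc.continuousAt.eventually ht
  have hcont : ∀ᶠ τ : ℝ in 𝓝 0,
      dist (slowDeriv v (f₀ a i) (x + τ • v)) (slowDeriv v (f₀ a i) x) < δ / 2 := by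
    have h1 := ((((hf.regular_limit a i).slowDeriv hU v).contDiffOn x
      (LinearMap.toSpanSingleton ℝ _ v)).contDiffAt ((hU.isOpen x
        (LinearMap.toSpanSingleton ℝ _ v)).mem_nhds (x := 0) (by simpa using hx))).continuousAt
    have h2 := Metric.tendsto_nhds.1 h1.tendsto _ (half_pos hδ)
    simpa using h2
  obtain ⟨r, hr, hball⟩ := Metric.eventually_nhds_iff_ball.1
    (ht'.and (hcont.and (hU.eventually_smul hx v)))
  have hmem : ∀ τ ∈ Set.Icc (-(r / 2)) (r / 2), τ ∈ Metric.ball (0 : ℝ) r := by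
    intro τ hτ
    rw [mem_ball_zero_iff, Real.norm_eq_abs, abs_lt]
    constructor <;> linarith [hτ.1, hτ.2]
  refine ⟨r / 2, half_pos hr, fun τ hτ => (hball τ (hmem τ hτ)).2.2, ?_⟩
  filter_upwards [hev, eventually_mem_Ioo hε₀] with ε hε hε' τ hτ
  obtain ⟨h1, h2, h3⟩ := hball τ (hmem τ hτ)
  have h4 := hε _ h1
  rw [dist_eq_norm] at h2 h4
  have h5 := (hf.regular ε hε' a i).slowDeriv_line_eq hU x v h3
  have h6 := (hf.regular_limit a i).slowDeriv_line_eq hU x v h3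
  have h7 : ‖slowDeriv v (f₀ a i) (x + τ • v) - slowDeriv v (f a i ε) (x + τ • v)‖ ≤ δ / 2 := by
    rw [h5, h6, ← sub_apply]
    refine (ContinuousLinearMap.le_opNorm _ _).trans ?_
    rw [pi_norm_const, norm_one, mul_one]
    exact h4.le
  calc _ = ‖(slowDeriv v (f₀ a i) (x + τ • v) - slowDeriv v (f₀ a i) x) -
        (slowDeriv v (f₀ a i) (x + τ • v) - slowDeriv v (f a i ε) (x + τ • v))‖ := by
        congr 1; ring
    _ ≤ δ / 2 + δ / 2 := (norm_sub_le _ _).trans (add_le_add h2.le h7)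
    _ = δ := add_halves δ

lemma IsQuasiclassical.tendsto_slowDeriv (hf : IsQuasiclassical ε₀ U S Sb n f f₀) (hε₀ : 0 < ε₀)
    (hU : IsSlowOpen U) {x : Slow N} (hx : x ∈ U) (v : Slow N) (a : Idx N) (i : ℕ) :
    Tendsto (fun ε => slowDeriv v (f a i ε) x) (𝓝[>] 0) (𝓝 (slowDeriv v (f₀ a i) x)) := by
  refine Metric.tendsto_nhds.2 fun δ hδ => ?_
  obtain ⟨r, hr, -, h⟩ := hf.slowDeriv_near hε₀ hU hx v a i (half_pos hδ)
  filter_upwards [h] with ε hε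
  have := hε 0 ⟨by linarith, hr.le⟩
  rw [zero_smul, add_zero] at this
  rw [dist_eq_norm]
  linarith

lemma IsQuasiclassical.tendsto_quotient (hf : IsQuasiclassical ε₀ U S Sb n f f₀) (hε₀ : 0 < ε₀)
    (hU : IsSlowOpen U) {x : Slow N} (hx : x ∈ U) (v : Slow N) (a : Idx N) (i k : ℕ) :
    Tendsto (fun ε : ℝ => (f a i ε (x + ((k : ℝ) * ε) • v) - f a i ε x) / (ε : ℂ)) (𝓝[>] 0)
      (𝓝 (k * slowDeriv v (f₀ a i) x)) := by
  refine Metric.tendsto_nhds.2 fun δ hδ => ?_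
  -- The denominator `k + 1` instead of `k` includes the case `k = 0`.
  have hk : (0 : ℝ) < k + 1 := by positivity
  obtain ⟨r, hr, hrU, h⟩ := hf.slowDeriv_near hε₀ hU hx v a i (div_pos hδ hk)
  have hsmall : ∀ᶠ ε in 𝓝[>] (0 : ℝ), ε < r / (k + 1) :=
    nhdsWithin_le_nhds (Iio_mem_nhds (div_pos hr hk))
  filter_upwards [h, eventually_mem_Ioo hε₀, hsmall] with ε hε hε' hs
  have hpos : 0 < ε := hε'.1
  have hkr : (k : ℝ) * ε ≤ r := by
    have := (lt_div_iff₀ hk).1 hs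
    nlinarith
  set d := slowDeriv v (f₀ a i) x
  -- With the linear function `τ d` removed, the derivative is small on the segment, and the mean
  -- value inequality applies between `0` and `k ε`.
  have hder : ∀ τ ∈ Set.Icc (-r) r, HasDerivWithinAt
      (fun τ : ℝ => f a i ε (x + τ • v) - (τ : ℂ) * d)
      (slowDeriv v (f a i ε) (x + τ • v) - d) (Set.Icc (-r) r) τ := by
    intro τ hτ
    have h1 := (hf.regular ε hε' a i).hasDerivAt_line hU x v (hrU τ hτ)
    have h2 : HasDerivAt (fun τ : ℝ => (τ : ℂ) * d) (1 * d) τ :=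
      (HasDerivAt.ofReal_comp (hasDerivAt_id τ)).mul_const d
    rw [one_mul] at h2
    exact (h1.sub h2).hasDerivWithinAt
  have hmvt := Convex.norm_image_sub_le_of_norm_hasDerivWithin_le hder hε (convex_Icc _ _)
    (x := 0) (y := (k : ℝ) * ε) ⟨by linarith, hr.le⟩ ⟨by nlinarith [k.cast_nonneg (α := ℝ)], hkr⟩
  have hε0 : (ε : ℂ) ≠ 0 := by exact_mod_cast hpos.ne'
  have e : (f a i ε (x + ((k : ℝ) * ε) • v) - f a i ε x) / (ε : ℂ) - k * d =
      (f a i ε (x + ((k : ℝ) * ε) • v) - (((k : ℝ) * ε : ℝ) : ℂ) * d -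
        (f a i ε (x + (0 : ℝ) • v) - ((0 : ℝ) : ℂ) * d)) / ε := by
    push_cast
    rw [zero_smul, add_zero]
    field_simp
    ring
  rw [dist_eq_norm, e, norm_div, Complex.norm_real, Real.norm_of_nonneg hpos.le,
    div_lt_iff₀ hpos]
  refine hmvt.trans_lt ?_
  rw [sub_zero, Real.norm_of_nonneg (by positivity), div_mul_eq_mul_div, div_lt_iff₀ hk]
  nlinarith [mul_pos hδ hpos]

end Limits

/-! ## Time derivatives in terms of charge derivatives -/

section TimeFlows

variable {N : ℕ}

/-- The series of the derivatives in the direction `v`. -/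
def serDeriv (v : Slow N) (f : Idx N → ℕ → Slow N → ℂ) (b : Idx N) (x : Slow N) : PowerSeries ℂ :=
  PowerSeries.mk fun i => slowDeriv v (f b i) x

/-- The series of the derivative of the phase at the puncture `b` in the time `t_{ja}`. -/
def timeSer (f : Idx N → ℕ → Slow N → ℂ) (a : Idx N) (j : ℕ+) (b : Idx N) (x : Slow N) :
    LaurentSeries ℂ :=
  HahnSeries.single (-(j : ℤ)) (if b = a then 1 else 0) +
    (serDeriv (dirT a j 1) f b x : LaurentSeries ℂ)

/-- The exponential of the derivative of the phase at the puncture `c` in the direction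
`dirS a b`. -/
def chargeExp (f : Idx N → ℕ → Slow N → ℂ) (a b c : Idx N) (x : Slow N) : LaurentSeries ℂ :=
  HahnSeries.single (-dirZ a b c) 1 * (expSeries (serDeriv (dirS a b) f c x) : LaurentSeries ℂ)

/-- The quotient of the exponential of a phase, shifted by `k ε` in the direction `dirS a b`, by the
original one. -/
def shiftQuot (g : Idx N → ℕ → Slow N → ℂ) (ε : ℝ) (a b : Idx N) (k : ℕ) (x : Slow N)
    (c : Idx N) : LaurentSeries ℂ :=
  HahnSeries.single (-(k * dirZ a b c)) (1 : ℂ) * (expSeries (PowerSeries.mk fun i =>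
    (g c i (x + ((k : ℝ) * ε) • dirS a b) - g c i x) / ε) : LaurentSeries ℂ)

lemma coeff_single_mul_coe (k r : ℤ) (G : PowerSeries ℂ) :
    (HahnSeries.single k (1 : ℂ) * (G : LaurentSeries ℂ)).coeff r =
      if r - k < 0 then 0 else PowerSeries.coeff (r - k).natAbs G := by
  rw [coeff_single_mul', PowerSeries.coeff_coe]

lemma coeff_shiftQuot_eq_zero {g : Idx N → ℕ → Slow N → ℂ} {ε : ℝ} {a b : Idx N} {k : ℕ}
    {x : Slow N} {c : Idx N} {r : ℤ} (h : r + k * dirZ a b c < 0) :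
    (shiftQuot g ε a b k x c).coeff r = 0 := by
  rw [shiftQuot, coeff_single_mul_coe, if_pos (by omega)]

lemma chargeExp_pow (f : Idx N → ℕ → Slow N → ℂ) (a b c : Idx N) (x : Slow N) (k : ℕ) :
    chargeExp f a b c x ^ k = HahnSeries.single (-(k * dirZ a b c)) 1 *
      (expSeries (k • serDeriv (dirS a b) f c x) : LaurentSeries ℂ) := by
  rw [chargeExp, mul_pow, expSeries_nsmul, PowerSeries.coe_pow, HahnSeries.single_pow, one_pow,
    smul_neg, nsmul_eq_mul]

/-- Column `i` starts at the exponent `-(i + s)`, so the matrix is upper triangular, with values of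
the exponential function on the diagonal. -/
lemma det_coeff_ne_zero (m s : ℕ) (G : Fin m → PowerSeries ℂ) :
    (Matrix.of fun k i : Fin m => (HahnSeries.single (-((i + s : ℕ) : ℤ)) (1 : ℂ) *
      (expSeries (G i) : LaurentSeries ℂ)).coeff (-((k + s : ℕ) : ℤ))).det ≠ 0 := by
  rw [Matrix.det_of_isUpperTriangular]
  · refine Finset.prod_ne_zero_iff.2 fun i _ => ?_
    rw [Matrix.of_apply, coeff_single_mul', PowerSeries.coeff_coe, sub_self, if_neg (lt_irrefl _)]
    simp [constantCoeff_expSeries]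
  · intro k i hki
    rw [Matrix.of_apply, coeff_single_mul', PowerSeries.coeff_coe, if_pos]
    have : (i : ℕ) < k := hki
    push_cast
    omega

variable [NeZero N] {ε₀ : ℝ} {U : Set (Slow N)} {S Sb : ℝ → Slow N → Op N} {n : ℝ → ℤ}
  {f : Idx N → ℕ → ℝ → Slow N → ℂ} {f₀ : Idx N → ℕ → Slow N → ℂ}

lemma IsQuasiclassical.shift_mem (hf : IsQuasiclassical ε₀ U S Sb n f f₀)
    (hT : ∀ ε ∈ Set.Ioo 0 ε₀, IsTodaSolution ε U (S ε) (Sb ε)) {ε : ℝ} (hε : ε ∈ Set.Ioo 0 ε₀)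
    {x : Slow N} {a b : Idx N} (hab : a ≠ b) (k : ℕ)
    (hU : ∀ l ≤ k, x + ((l : ℝ) * ε) • dirS a b ∈ U) :
    shiftQuot (fun b i => f b i ε) ε a b k x ∈ quotMod (S ε x) (Sb ε x) (n ε) := by
  have h := (hT ε hε).shift_mem (n := n ε) (F := fun c x => PowerSeries.mk fun i => f c i ε x / ε)
    (fun x hx a => hf.wave ε hε x hx a) hab k hU
  have e : ∀ c, (PowerSeries.mk fun i => f c i ε (x + ((k : ℝ) * ε) • dirS a b) / (ε : ℂ)) -
      (PowerSeries.mk fun i => f c i ε x / (ε : ℂ)) =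
      PowerSeries.mk fun i => (f c i ε (x + ((k : ℝ) * ε) • dirS a b) - f c i ε x) / (ε : ℂ) := by
    intro c
    ext i
    simp [sub_div]
  simp only [e] at h
  exact h

lemma IsQuasiclassical.time_mem (hf : IsQuasiclassical ε₀ U S Sb n f f₀)
    (hT : ∀ ε ∈ Set.Ioo 0 ε₀, IsTodaSolution ε U (S ε) (Sb ε)) (hU : IsSlowOpen U) {ε : ℝ}
    (hε : ε ∈ Set.Ioo 0 ε₀) {x : Slow N} (hx : x ∈ U) (a : Idx N) (j : ℕ+) :
    (fun c => timeSer (fun b i => f b i ε) a j c x) ∈ quotMod (S ε x) (Sb ε x) (n ε) := by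
  have hε0 : (ε : ℂ) ≠ 0 := by exact_mod_cast hε.1.ne'
  have h := (hT ε hε).time_mem (n := n ε) hU
    (F := fun c x => PowerSeries.mk fun i => f c i ε x / ε)
    (fun x hx a => hf.wave ε hε x hx a) (fun c i => by
      simpa [div_eq_mul_inv] using (hf.regular ε hε c i).mul (isSlowFunction_const (ε : ℂ)⁻¹)) hx a j
  have e : ∀ c, (ε : ℂ) • (PowerSeries.mk fun i => slowDeriv (dirT a j 1) (fun x =>
      PowerSeries.coeff i (PowerSeries.mk fun i => f c i ε x / (ε : ℂ))) x) =
      serDeriv (dirT a j 1) (fun b i => f b i ε) c x := by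
    intro c
    ext i
    simp only [PowerSeries.coeff_smul, PowerSeries.coeff_mk, serDeriv, slowDeriv, deriv_div_const,
      smul_eq_mul]
    field_simp
  simp only [← PowerSeries.coe_smul, e] at h
  exact h

/-- At each small `ε`, the logarithmic time derivatives are combinations of quotients of shifted
wave functions. -/
lemma IsQuasiclassical.exists_combination (hf : IsQuasiclassical ε₀ U S Sb n f f₀)
    (hT : ∀ ε ∈ Set.Ioo 0 ε₀, IsTodaSolution ε U (S ε) (Sb ε)) (hU : IsSlowOpen U) {ε : ℝ}
    (hε : ε ∈ Set.Ioo 0 ε₀) {x : Slow N} (hx : x ∈ U) {a b : Idx N} (hab : a ≠ b) (j : ℕ+)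
    {m s : ℕ} (hms : m + s = j + 1) (h0 : a = one → s = 0) (h1 : a ≠ one → b = one ∧ s = 1)
    (hsh : ∀ l ≤ (j : ℕ), x + ((l : ℝ) * ε) • dirS a b ∈ U) :
    ∃ c : Fin m → ℂ, ∀ d, timeSer (fun b i => f b i ε) a j d x = ∑ i : Fin m, c i •
      shiftQuot (fun b i => f b i ε) ε a b (i + s) x d := by
  set V : Fin m → Idx N → LaurentSeries ℂ := fun i d =>
    shiftQuot (fun b i => f b i ε) ε a b (i + s) x d with hV
  have hVmem : ∀ i, V i ∈ quotMod (S ε x) (Sb ε x) (n ε) := fun i =>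
    hf.shift_mem hT hε hab (i + s) fun l hl => hsh l (by omega)
  set u : Idx N → LaurentSeries ℂ := fun d => timeSer (fun b i => f b i ε) a j d x with hu
  have hda : dirZ a b a = 1 := by simp [dirZ, hab]
  set M : Matrix (Fin m) (Fin m) ℂ :=
    Matrix.of fun k i => (V i a).coeff (-((k + s : ℕ) : ℤ)) with hM
  have hdet : IsUnit M.det := by
    rw [isUnit_iff_ne_zero, hM]
    simp only [hV, shiftQuot, hda, mul_one]
    exact det_coeff_ne_zero m s _
  -- The coefficients are chosen to match the exponents `-s, …, -j` at the puncture `a`.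
  set c : Fin m → ℂ := M⁻¹.mulVec fun k => (u a).coeff (-((k + s : ℕ) : ℤ)) with hc
  have hMc : ∀ k : Fin m, (u a).coeff (-((k + s : ℕ) : ℤ)) =
      ∑ i, c i * (V i a).coeff (-((k + s : ℕ) : ℤ)) := by
    intro k
    have : M.mulVec c = fun k : Fin m => (u a).coeff (-((k + s : ℕ) : ℤ)) := by
      rw [hc, Matrix.mulVec_mulVec, Matrix.mul_nonsing_inv _ hdet, Matrix.one_mulVec]
    rw [← congrFun this k]
    simp only [Matrix.mulVec, dotProduct]
    exact Finset.sum_congr rfl fun i _ => mul_comm (M k i) (c i)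
  refine ⟨c, fun d => ?_⟩
  have hQ : u - ∑ i, c i • V i = 0 := by
    refine eq_zero_of_mem_quotMod (fun n => (hT ε hε).lower x hx n)
      (fun n => (hT ε hε).upper x hx n)
      (fun b => by rw [hf.wave ε hε x hx b]; exact expSeries_ne_zero _)
      (Submodule.sub_mem _ (hf.time_mem hT hU hε hx a j)
        (Submodule.sum_mem _ fun i _ => Submodule.smul_mem _ _ (hVmem i))) ?_ ?_
    all_goals simp only [Pi.sub_apply, Finset.sum_apply, Pi.smul_apply, HahnSeries.coeff_sub,
      HahnSeries.coeff_sum, HahnSeries.coeff_smul, smul_eq_mul]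
    · intro d r hr
      by_cases hd : d = a
      · subst hd
        by_cases hrj : -(j : ℤ) ≤ r
        · by_cases hrs : r ≤ -(s : ℤ)
          · obtain ⟨k, rfl⟩ : ∃ k : Fin m, r = -((k + s : ℕ) : ℤ) :=
              ⟨⟨(-r - s).toNat, by omega⟩, by push_cast; omega⟩
            rw [hMc, sub_self]
          -- Since `s ≤ 1`, no negative exponent lies above `-s`.
          · have : s = 0 ∨ s = 1 := by
              by_cases hd : d = one
              exacts [Or.inl (h0 hd), Or.inr (h1 hd).2]
            omega
        · have e1 : (u d).coeff r = 0 := by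
            simp only [hu, timeSer, HahnSeries.coeff_add, PowerSeries.coeff_coe, if_pos hr,
              add_zero]
            exact HahnSeries.coeff_single_of_ne (by omega)
          have e2 : ∀ i, (V i d).coeff r = 0 := fun i =>
            coeff_shiftQuot_eq_zero (by rw [hda, mul_one]; omega)
          simp [e1, e2]
      · have e1 : (u d).coeff r = 0 := by
          simp [hu, timeSer, hd, PowerSeries.coeff_coe, hr]
        have hd0 : dirZ a b d ≤ 0 := by
          simp only [dirZ, hd, if_false]
          split_ifs <;> omega
        have e2 : ∀ i, (V i d).coeff r = 0 := fun i => coeff_shiftQuot_eq_zero (by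
          have := mul_nonpos_of_nonneg_of_nonpos (Int.natCast_nonneg ((i : ℕ) + s)) hd0
          omega)
        simp [e1, e2]
    -- The value at the puncture 1: for `a = 1` it is among the matched exponents, as `s = 0`.
    -- Otherwise the time derivative has value zero by the normalization of `f one 0`, and the
    -- ratios vanish because `s_1` is lowered at least once.
    · by_cases ha : a = one
      · obtain rfl := h0 ha
        have := hMc ⟨0, by omega⟩
        simp only [Nat.add_zero, Nat.cast_zero, neg_zero] at this
        rw [← ha, this, sub_self]
      · obtain ⟨rfl, rfl⟩ := h1 ha
        have e1 : (u one).coeff 0 = 0 := by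
          have : slowDeriv (dirT a j 1) (f one 0 ε) x = 0 := by
            have h2 := (hf.regular ε hε one 0).hasDerivAt_time hU hx a j
            refine h2.unique ((hasDerivAt_const (0 : ℂ) (0 : ℂ)).congr_of_eventuallyEq ?_)
            filter_upwards [hU.eventually_dirT hx a j] with τ hτ
            exact hf.normalized ε hε _ hτ
          simp [hu, timeSer, Ne.symm ha, PowerSeries.coeff_coe, serDeriv, this]
        have e2 : ∀ i, (V i one).coeff 0 = 0 := fun i => coeff_shiftQuot_eq_zero (by
          simp only [dirZ, Ne.symm ha, if_false, if_true]
          push_cast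
          omega)
        simp [e1, e2]
  have := congrFun (sub_eq_zero.1 hQ) d
  simpa using this

/-- In the dispersionless limit, the time derivatives of the phases are polynomials of the
exponentials of their charge derivatives. -/
theorem IsQuasiclassical.timeSer_eq (hf : IsQuasiclassical ε₀ U S Sb n f f₀) (hε₀ : 0 < ε₀)
    (hT : ∀ ε ∈ Set.Ioo 0 ε₀, IsTodaSolution ε U (S ε) (Sb ε)) (hU : IsSlowOpen U)
    {x : Slow N} (hx : x ∈ U) {a b : Idx N} (hab : a ≠ b) (j : ℕ+)
    {m s : ℕ} (hms : m + s = j + 1) (h0 : a = one → s = 0) (h1 : a ≠ one → b = one ∧ s = 1) :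
    ∃ c : Fin m → ℂ, ∀ d, timeSer f₀ a j d x =
      ∑ i : Fin m, c i • chargeExp f₀ a b d x ^ ((i : ℕ) + s) := by
  have hda : dirZ a b a = 1 := by simp [dirZ, hab]
  have hsh : ∀ᶠ ε in 𝓝[>] (0 : ℝ), ∀ l ≤ (j : ℕ), x + ((l : ℝ) * ε) • dirS a b ∈ U := by
    have : ∀ l : ℕ, ∀ᶠ ε in 𝓝[>] (0 : ℝ), x + ((l : ℝ) * ε) • dirS a b ∈ U := fun l => by
      refine Filter.Tendsto.eventually (f := fun ε : ℝ => (l : ℝ) * ε) (l₂ := 𝓝 0) ?_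
        (hU.eventually_smul hx (dirS a b))
      have h2 : Continuous fun ε : ℝ => (l : ℝ) * ε := by fun_prop
      simpa using (h2.tendsto 0).mono_left nhdsWithin_le_nhds
    have h3 := (Filter.eventually_all_finite (Set.finite_Iic (j : ℕ))).2 fun l _ => this l
    exact h3
  -- The equations are indexed by a puncture and an exponent; the selected ones form the triangular
  -- system at `a`.
  have hlim := exists_limit_combination (l := 𝓝[>] (0 : ℝ)) (ι := Fin m) (β := Idx N × ℤ)
    (u := fun ε p => (timeSer (fun b i => f b i ε) a j p.1 x).coeff p.2)
    (u₀ := fun p => (timeSer f₀ a j p.1 x).coeff p.2)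
    (v := fun ε i p => (shiftQuot (fun b i => f b i ε) ε a b (i + s) x p.1).coeff p.2)
    (v₀ := fun i p => (chargeExp f₀ a b p.1 x ^ ((i : ℕ) + s)).coeff p.2)
    ?_ ?_ (fun k => (a, -((k + s : ℕ) : ℤ))) ?_ ?_
  · obtain ⟨c, hc⟩ := hlim
    refine ⟨c, fun d => ?_⟩
    ext r
    simpa using hc (d, r)
  · rintro ⟨d, r⟩
    simp only [timeSer, HahnSeries.coeff_add, PowerSeries.coeff_coe, serDeriv,
      PowerSeries.coeff_mk]
    refine tendsto_const_nhds.add ?_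
    split_ifs
    · exact tendsto_const_nhds
    · exact hf.tendsto_slowDeriv hε₀ hU hx _ _ _
  · rintro i ⟨d, r⟩
    simp only [chargeExp_pow, shiftQuot, coeff_single_mul_coe]
    split_ifs
    · exact tendsto_const_nhds
    · refine tendsto_coeff_expSeries (fun q => ?_) _
      rw [map_nsmul, nsmul_eq_mul]
      simpa only [serDeriv, PowerSeries.coeff_mk] using
        hf.tendsto_quotient hε₀ hU hx (dirS a b) d q (i + s)
  · simp only [chargeExp_pow, hda, mul_one]
    exact det_coeff_ne_zero m s _
  · filter_upwards [hsh, eventually_mem_Ioo hε₀] with ε h2 hε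
    obtain ⟨c, hc⟩ := hf.exists_combination hT hU hε hx hab j hms h0 h1 h2
    refine ⟨c, fun p => ?_⟩
    simp only [hc p.1, HahnSeries.coeff_sum, HahnSeries.coeff_smul, smul_eq_mul]

end TimeFlows

/-! ## The leading phases -/

section LeadingPhase

variable {N : ℕ} [NeZero N] {ε₀ : ℝ} {U : Set (Slow N)} {S Sb : ℝ → Slow N → Op N} {n : ℝ → ℤ}
  {f : Idx N → ℕ → ℝ → Slow N → ℂ} {f₀ : Idx N → ℕ → Slow N → ℂ}

omit [NeZero N] in
lemma slowDeriv_neg (v : Slow N) (g : Slow N → ℂ) (x : Slow N) :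
    slowDeriv (-v) g x = -slowDeriv v g x := by
  have := deriv_comp_neg (fun τ : ℝ => g (x + τ • v)) 0
  have e : ∀ τ : ℝ, τ • -v = -τ • v := fun τ => by module
  simpa only [slowDeriv, e, neg_zero] using this

omit [NeZero N] in
lemma chargeExp_mul_swap (f₀ : Idx N → ℕ → Slow N → ℂ) (a b c : Idx N) (x : Slow N) :
    chargeExp f₀ a b c x * chargeExp f₀ b a c x = 1 := by
  have h1 : serDeriv (dirS b a) f₀ c x = -serDeriv (dirS a b) f₀ c x := by
    ext i
    simp [serDeriv, dirS_swap a b, slowDeriv_neg]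
  have h2 : dirZ b a c = -dirZ a b c := by simp [dirZ]
  rw [chargeExp, chargeExp, h1, h2, mul_mul_mul_comm, ← PowerSeries.coe_mul, expSeries_mul_neg,
    PowerSeries.coe_one, mul_one, HahnSeries.single_mul_single]
  simp

lemma IsQuasiclassical.limit_normalized (hf : IsQuasiclassical ε₀ U S Sb n f f₀) (hε₀ : 0 < ε₀)
    {x : Slow N} (hx : x ∈ U) : f₀ one 0 x = 0 := by
  have h1 := (hf.limit one 0 x 0 0).tendsto_at (a := 0) (by simpa using hx)
  simp only [LinearMap.zero_apply, add_zero] at h1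
  refine tendsto_nhds_unique h1 (tendsto_const_nhds.congr' ?_)
  filter_upwards [eventually_mem_Ioo hε₀] with ε hε
  rw [hf.normalized ε hε _ hx]

lemma IsQuasiclassical.slowDeriv_normalized (hf : IsQuasiclassical ε₀ U S Sb n f f₀)
    (hε₀ : 0 < ε₀) (hU : IsSlowOpen U) {x : Slow N} (hx : x ∈ U) (v : Slow N) :
    slowDeriv v (f₀ one 0) x = 0 := by
  refine HasDerivAt.deriv ((hasDerivAt_const (0 : ℝ) (0 : ℂ)).congr_of_eventuallyEq ?_)
  filter_upwards [hU.eventually_smul hx v] with τ hτ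
  exact hf.limit_normalized hε₀ hτ

/-- The charge flows: `exp (-∂_a 𝒮_b) = ∂𝒮_b/∂t_{11} - q_a`. -/
lemma IsQuasiclassical.chargeExp_eq (hf : IsQuasiclassical ε₀ U S Sb n f f₀) (hε₀ : 0 < ε₀)
    (hT : ∀ ε ∈ Set.Ioo 0 ε₀, IsTodaSolution ε U (S ε) (Sb ε)) (hU : IsSlowOpen U)
    {x : Slow N} (hx : x ∈ U) {a : Idx N} (ha : a ≠ one) (b : Idx N) :
    chargeExp f₀ one a b x = timeSer f₀ one 1 b x - HahnSeries.C (puncture f₀ a x) := by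
  -- For `j = 1` the polynomial is `c 0 + c 1 * E`. The coefficients of `w⁻¹` and `w⁰` at the
  -- puncture 1 give `c 1 = 1` and `c 0 = q_a`, and these values hold at every puncture.
  obtain ⟨c, hc⟩ := hf.timeSer_eq hε₀ hT hU hx (Ne.symm ha) 1 (m := 2) (s := 0) (by simp)
    (fun _ => rfl) (fun h => absurd rfl h)
  simp only [Fin.sum_univ_two, Fin.val_zero, Fin.val_one, add_zero, pow_zero, pow_one] at hc
  have h0 := hf.slowDeriv_normalized hε₀ hU hx
  have hd : dirZ one a one = 1 := by simp [dirZ, Ne.symm ha]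
  have e1 : (timeSer f₀ one 1 one x).coeff (-1) = 1 := by
    simp [timeSer, PowerSeries.coeff_coe]
  have e2 : (timeSer f₀ one 1 one x).coeff 0 = 0 := by
    simp [timeSer, PowerSeries.coeff_coe, serDeriv, h0]
  have g0 : PowerSeries.constantCoeff (serDeriv (dirS one a) f₀ one x) = 0 := by
    rw [← PowerSeries.coeff_zero_eq_constantCoeff_apply, serDeriv, PowerSeries.coeff_mk, h0]
  have g1 : PowerSeries.coeff 1 (serDeriv (dirS one a) f₀ one x) = -puncture f₀ a x := by
    rw [serDeriv, PowerSeries.coeff_mk, dirS_swap a one, slowDeriv_neg]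
    rfl
  have e3 : (chargeExp f₀ one a one x).coeff (-1) = 1 := by
    rw [chargeExp, coeff_single_mul_coe, hd]
    simp [constantCoeff_expSeries, g0]
  have e4 : (chargeExp f₀ one a one x).coeff 0 = -puncture f₀ a x := by
    rw [chargeExp, coeff_single_mul_coe, hd]
    have := coeff_succ_expSeries (serDeriv (dirS one a) f₀ one x) 0
    simp [constantCoeff_expSeries, g0, g1] at this
    simpa using this
  have hc1 : c 1 = 1 := by
    have := congrArg (fun F => F.coeff (-1)) (hc one)
    simpa [e1, e3] using this.symm
  have hc0 : c 0 = puncture f₀ a x := by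
    have := congrArg (fun F => F.coeff 0) (hc one)
    simp [e2, e4, hc1] at this
    linear_combination -this
  rw [hc b, hc1, hc0, one_smul, ← HahnSeries.C_mul_eq_smul, mul_one, add_sub_cancel_left]

lemma IsQuasiclassical.chargeExp_eq_inv (hf : IsQuasiclassical ε₀ U S Sb n f f₀) (hε₀ : 0 < ε₀)
    (hT : ∀ ε ∈ Set.Ioo 0 ε₀, IsTodaSolution ε U (S ε) (Sb ε)) (hU : IsSlowOpen U)
    {x : Slow N} (hx : x ∈ U) {a : Idx N} (ha : a ≠ one) (b : Idx N) :
    chargeExp f₀ a one b x = (timeSer f₀ one 1 b x - HahnSeries.C (puncture f₀ a x))⁻¹ := by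
  rw [← hf.chargeExp_eq hε₀ hT hU hx ha]
  exact eq_inv_of_mul_eq_one_left (chargeExp_mul_swap _ _ _ _ _)

lemma timeSer_one_of_ne {a : Idx N} (ha : a ≠ one) (x : Slow N) :
    timeSer f₀ one 1 a x = (serDeriv (dirT one 1 1) f₀ a x : LaurentSeries ℂ) := by
  simp [timeSer, ha]

/-- At its own puncture the exponential in `chargeExp_eq` carries one factor `w`: thus `p - q_a` has
a simple zero there. -/
lemma IsQuasiclassical.serDeriv_eq (hf : IsQuasiclassical ε₀ U S Sb n f f₀) (hε₀ : 0 < ε₀)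
    (hT : ∀ ε ∈ Set.Ioo 0 ε₀, IsTodaSolution ε U (S ε) (Sb ε)) (hU : IsSlowOpen U)
    {x : Slow N} (hx : x ∈ U) {a : Idx N} (ha : a ≠ one) :
    serDeriv (dirT one 1 1) f₀ a x - PowerSeries.C (puncture f₀ a x) =
      PowerSeries.X * expSeries (serDeriv (dirS one a) f₀ a x) := by
  apply HahnSeries.ofPowerSeries_injective (Γ := ℤ)
  have h := hf.chargeExp_eq hε₀ hT hU hx ha a
  rw [timeSer_one_of_ne ha, chargeExp] at h
  have hd : -dirZ one a a = 1 := by simp [dirZ, ha]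
  rw [hd] at h
  rw [PowerSeries.coe_sub, PowerSeries.coe_mul, PowerSeries.coe_C, PowerSeries.coe_X, h]

/-- At the puncture `a` the shift does not change the charge, so `p - q_b` is the exponential of a
power series; its constant term `q_a - q_b` is non-zero. -/
lemma IsQuasiclassical.puncture_ne (hf : IsQuasiclassical ε₀ U S Sb n f f₀) (hε₀ : 0 < ε₀)
    (hT : ∀ ε ∈ Set.Ioo 0 ε₀, IsTodaSolution ε U (S ε) (Sb ε)) (hU : IsSlowOpen U)
    {x : Slow N} (hx : x ∈ U) {a b : Idx N} (ha : a ≠ one) (hb : b ≠ one) (hab : a ≠ b) :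
    puncture f₀ a x ≠ puncture f₀ b x := by
  have h := hf.chargeExp_eq hε₀ hT hU hx hb a
  have hd : -dirZ one b a = 0 := by simp [dirZ, ha, hab]
  rw [timeSer_one_of_ne ha, chargeExp, hd, sub_eq_iff_eq_add.1 (hf.serDeriv_eq hε₀ hT hU hx ha)] at h
  have h2 := congrArg (fun F => F.coeff 0) h
  simp only [coeff_single_mul_coe, HahnSeries.coeff_sub, PowerSeries.coeff_coe] at h2
  intro he
  simp [constantCoeff_expSeries, he] at h2

/-- The local parameter at a puncture, as a series in `w`. -/
lemma IsQuasiclassical.exists_localParam (hf : IsQuasiclassical ε₀ U S Sb n f f₀) (hε₀ : 0 < ε₀)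
    (hT : ∀ ε ∈ Set.Ioo 0 ε₀, IsTodaSolution ε U (S ε) (Sb ε)) (hU : IsSlowOpen U) (a : Idx N) :
    ∃ h : Slow N → PowerSeries ℂ, (∀ i, IsSlowFunction U fun x => PowerSeries.coeff i (h x)) ∧
      ∀ x ∈ U, PowerSeries.constantCoeff (h x) = 0 ∧ PowerSeries.coeff 1 (h x) ≠ 0 ∧
        (a = one → timeSer f₀ one 1 a x = (h x : LaurentSeries ℂ)⁻¹) ∧
        (a ≠ one → timeSer f₀ one 1 a x =
          HahnSeries.C (puncture f₀ a x) + (h x : LaurentSeries ℂ)) := by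
  have hslow : ∀ i, IsSlowFunction U fun x =>
      PowerSeries.coeff i (serDeriv (dirT one 1 1) f₀ a x) := fun i => by
    simpa [serDeriv] using (hf.regular_limit a i).slowDeriv hU _
  by_cases ha : a = one
  -- At infinity `p = w⁻¹ (1 + w ⋯)`, and `1 / p` is `w` times the inverse of the bracket.
  · have h1 : ∀ i, IsSlowFunction U fun x =>
        PowerSeries.coeff i (1 + PowerSeries.X * serDeriv (dirT one 1 1) f₀ a x) := by
      intro i
      cases i with
      | zero => simpa using isSlowFunction_const 1
      | succ i => simpa [PowerSeries.coeff_one] using hslow i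
    obtain ⟨H, hH, e⟩ := exists_slow_inv hU h1 (fun x _ => by simp)
    refine ⟨fun x => PowerSeries.X * H x, fun i => ?_, fun x hx => ⟨by simp, ?_, fun _ => ?_,
      fun h => absurd ha h⟩⟩
    · cases i with
      | zero => simpa using isSlowFunction_const 0
      | succ i => simpa using hH i
    · intro h2
      have h3 := congrArg PowerSeries.constantCoeff (e x hx)
      rw [PowerSeries.coeff_succ_X_mul, PowerSeries.coeff_zero_eq_constantCoeff_apply] at h2
      simp [h2] at h3
    · refine eq_inv_of_mul_eq_one_left ?_
      have h2 : timeSer f₀ one 1 a x = HahnSeries.single (-1) 1 *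
          ((1 + PowerSeries.X * serDeriv (dirT one 1 1) f₀ a x : PowerSeries ℂ) :
            LaurentSeries ℂ) := by
        rw [PowerSeries.coe_add, PowerSeries.coe_mul, PowerSeries.coe_X, PowerSeries.coe_one,
          mul_add, ← mul_assoc, HahnSeries.single_mul_single]
        simp [timeSer, ha]
      rw [h2, PowerSeries.coe_mul, PowerSeries.coe_X, mul_mul_mul_comm,
        HahnSeries.single_mul_single, ← PowerSeries.coe_mul, e x hx]
      simp
  · refine ⟨fun x => serDeriv (dirT one 1 1) f₀ a x - PowerSeries.C (puncture f₀ a x),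
      fun i => ?_, fun x hx => ⟨?_, ?_, fun h => absurd h ha, fun _ => ?_⟩⟩
    · have hq : IsSlowFunction U (puncture f₀ a) := (hf.regular_limit one 1).slowDeriv hU _
      cases i with
      | zero => simpa [sub_eq_add_neg] using (hslow 0).add hq.neg
      | succ i => simpa [PowerSeries.coeff_C] using hslow (i + 1)
    · simp only [hf.serDeriv_eq hε₀ hT hU hx ha]
      simp
    · simp only [hf.serDeriv_eq hε₀ hT hU hx ha]
      rw [PowerSeries.coeff_succ_X_mul, PowerSeries.coeff_zero_eq_constantCoeff_apply,
        constantCoeff_expSeries]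
      exact Complex.exp_ne_zero _
    · rw [timeSer_one_of_ne ha, PowerSeries.coe_sub, PowerSeries.coe_C, add_sub_cancel]

omit [NeZero N] in
lemma hasTimeDeriv_leadingPhase {f₀ : Idx N → ℕ → Slow N → ℂ}
    (hreg : ∀ a i, IsSlowFunction U (f₀ a i)) (hU : IsSlowOpen U)
    {x : Slow N} (hx : x ∈ U) (n₀ : ℝ) (a : Idx N) (j : ℕ+) (b : Idx N) :
    HasTimeDeriv (leadingPhase n₀ f₀ b) a j x ⟨0, timeSer f₀ a j b x⟩ := by
  constructor
  · simp only [leadingPhase]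
    refine (hasDerivAt_const (0 : ℂ) ((sg b : ℂ) * n₀ + (x.1.1 b : ℝ))).congr_of_eventuallyEq ?_
    exact Filter.Eventually.of_forall fun τ => by simp [dirT]
  · intro i
    have e : ∀ τ : ℂ, (leadingPhase n₀ f₀ b (x + dirT a j τ)).ser.coeff i =
        ((x.1.2 b).sum fun j c => (HahnSeries.single (-(j : ℤ)) c : LaurentSeries ℂ)).coeff i +
          τ * (HahnSeries.single (-(j : ℤ)) (if b = a then (1 : ℂ) else 0) :
            LaurentSeries ℂ).coeff i +
          ((PowerSeries.mk fun i => f₀ b i (x + dirT a j τ) : PowerSeries ℂ) :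
            LaurentSeries ℂ).coeff i := by
      intro τ
      have h1 : (x + dirT a j τ).1.2 b =
          x.1.2 b + Finsupp.single j (if b = a then τ else 0) := by
        by_cases h : b = a
        · subst h; simp [dirT]
        · simp [dirT, h]
      simp only [leadingPhase, h1]
      rw [Finsupp.sum_add_index' (fun _ => by simp) (fun _ _ _ => by simp),
        Finsupp.sum_single_index (by simp), HahnSeries.coeff_add, HahnSeries.coeff_add]
      congr 2
      split_ifs <;> simp [HahnSeries.coeff_single]
    simp only [e, timeSer, HahnSeries.coeff_add]
    have h2 := (hasDerivAt_id (0 : ℂ)).mul_const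
      ((HahnSeries.single (-(j : ℤ)) (if b = a then (1 : ℂ) else 0) : LaurentSeries ℂ).coeff i)
    rw [one_mul] at h2
    refine (h2.const_add _).add ?_
    simp only [PowerSeries.coeff_coe, PowerSeries.coeff_mk, serDeriv]
    split_ifs
    · exact hasDerivAt_const _ _
    · exact (hreg b _).hasDerivAt_time hU hx a j

lemma hasChargeDeriv_leadingPhase (hreg : ∀ a i, IsSlowFunction U (f₀ a i)) (hU : IsSlowOpen U)
    {x : Slow N} (hx : x ∈ U) (n₀ : ℝ) (a b : Idx N) :
    HasChargeDeriv (leadingPhase n₀ f₀ b) a x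
      ⟨dirZ a one b, (serDeriv (dirS a one) f₀ b x : LaurentSeries ℂ)⟩ := by
  constructor
  · have h1 : ∀ τ : ℝ, (leadingPhase n₀ f₀ b (x + τ • dirS a one)).log =
        ((sg b : ℂ) * n₀ + (x.1.1 b : ℝ)) + (τ : ℂ) * (dirZ a one b : ℂ) := by
      intro τ
      have h2 : (x + τ • dirS a one).1.1 b = x.1.1 b + τ * (dirZ a one b : ℝ) := by
        simp [dirS, dirZ, Pi.single_apply]
      rw [leadingPhase, h2]
      push_cast
      ring
    simp only [h1]
    have h2 := (HasDerivAt.ofReal_comp (hasDerivAt_id (0 : ℝ))).mul_const (dirZ a one b : ℂ)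
    simpa using h2.const_add ((sg b : ℂ) * n₀ + (x.1.1 b : ℝ))
  · intro i
    have h1 : ∀ τ : ℝ, (x + τ • dirS a one).1.2 b = x.1.2 b := by
      intro τ; simp [dirS]
    simp only [leadingPhase, h1, HahnSeries.coeff_add]
    refine HasDerivAt.const_add _ ?_
    simp only [PowerSeries.coeff_coe, PowerSeries.coeff_mk, serDeriv]
    split_ifs
    · exact hasDerivAt_const _ _
    · have := (hreg b i.natAbs).hasDerivAt_line hU x (dirS a one) (τ := 0) (by simpa using hx)
      simpa only [zero_smul, add_zero] using this

omit [NeZero N] in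
lemma HasTimeDeriv.unique {F : Slow N → Phase} {a : Idx N} {j : ℕ+} {x : Slow N} {P Q : Phase}
    (hP : HasTimeDeriv F a j x P) (hQ : HasTimeDeriv F a j x Q) : P.ser = Q.ser := by
  ext i
  exact (hP.2 i).unique (hQ.2 i)

end LeadingPhase

/-! ## The Lax functions -/

section Lax

open PowerSeries

/-- In terms of the local parameter `h`, the Lax equation is `h(W) = ξ` at infinity and at finite
punctures alike. -/
lemma laurentSubst_eq_iff {N : ℕ} [NeZero N] {q : Idx N → ℂ} {a : Idx N} {T : LaurentSeries ℂ}
    {h W : PowerSeries ℂ} (h1 : a = one → T = (h : LaurentSeries ℂ)⁻¹)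
    (h2 : a ≠ one → T = HahnSeries.C (q a) + (h : LaurentSeries ℂ))
    (hW0 : constantCoeff W = 0) (hW : W ≠ 0) :
    laurentSubst W hW0 hW T = pAt q a ↔ h.subst W = X := by
  rw [← (HahnSeries.ofPowerSeries_injective (Γ := ℤ) (R := ℂ)).eq_iff, ← laurentSubst_coe hW0 hW,
    PowerSeries.coe_X]
  by_cases ha : a = one
  · have : (HahnSeries.single (-1) 1 : LaurentSeries ℂ) = (HahnSeries.single 1 1)⁻¹ := by
      rw [single_zpow_one, zpow_neg_one]
    rw [h1 ha, map_inv₀, pAt, if_pos ha, this, inv_inj]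
  · rw [h2 ha, map_add, laurentSubst_C, pAt, if_neg ha, add_right_inj]

lemma sg_mul_self {N : ℕ} (a : Idx N) : sg a * sg a = 1 := by
  cases a <;> rfl

lemma zpow_neg_sg_zpow_neg_sg {N : ℕ} (a : Idx N) (F : LaurentSeries ℂ) :
    (F ^ (-sg a)) ^ (-sg a) = F := by
  rw [← zpow_mul, neg_mul_neg, sg_mul_self, zpow_one]

lemma eq_X_mul_of_constantCoeff_eq_zero {W : PowerSeries ℂ} (h : constantCoeff W = 0) :
    W = X * PowerSeries.mk fun i => coeff (i + 1) W := by
  ext i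
  cases i with
  | zero => simpa using h
  | succ i => simp

lemma eq_C_add_X_mul (W : PowerSeries ℂ) :
    W = C (constantCoeff W) + X * PowerSeries.mk fun i => coeff (i + 1) W := by
  ext i
  cases i with
  | zero => simp
  | succ i => simp

lemma pAt_ne_C {N : ℕ} [NeZero N] (q : Idx N → ℂ) (a : Idx N) (c : ℂ) :
    HahnSeries.C c ≠ pAt q a := by
  intro h
  by_cases ha : a = one
  · have := congrArg (fun F : LaurentSeries ℂ => F.coeff (-1)) h
    simp [pAt, ha, HahnSeries.C_apply] at this
  · have := congrArg (fun F : LaurentSeries ℂ => F.coeff 1) h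
    simp [pAt, ha, HahnSeries.C_apply] at this

variable {N : ℕ} [NeZero N] {ε₀ : ℝ} {U : Set (Slow N)} {S Sb : ℝ → Slow N → Op N} {n : ℝ → ℤ}
  {f : Idx N → ℕ → ℝ → Slow N → ℂ} {f₀ : Idx N → ℕ → Slow N → ℂ}

/-- The inverse of the local coordinate at each puncture as a series in the local parameter. -/
lemma IsQuasiclassical.exists_localCoord (hf : IsQuasiclassical ε₀ U S Sb n f f₀) (hε₀ : 0 < ε₀)
    (hT : ∀ ε ∈ Set.Ioo 0 ε₀, IsTodaSolution ε U (S ε) (Sb ε)) (hU : IsSlowOpen U) (a : Idx N) :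
    ∃ W V : Slow N → PowerSeries ℂ,
      (∀ i, IsSlowFunction U fun x => PowerSeries.coeff i (V x)) ∧
      ∀ x ∈ U, (W x : LaurentSeries ℂ)⁻¹ = HahnSeries.single (-1) 1 * (V x : LaurentSeries ℂ) ∧
        constantCoeff (V x) ≠ 0 ∧
        (∃ (h0 : constantCoeff (W x) = 0) (hW : W x ≠ 0),
          laurentSubst (W x) h0 hW (timeSer f₀ one 1 a x) = pAt (fun b => puncture f₀ b x) a) ∧
        ∀ (W' : PowerSeries ℂ) (h0 : constantCoeff W' = 0) (hW : W' ≠ 0),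
          laurentSubst W' h0 hW (timeSer f₀ one 1 a x) = pAt (fun b => puncture f₀ b x) a →
            W' = W x := by
  obtain ⟨h, hslow, hh⟩ := hf.exists_localParam hε₀ hT hU a
  obtain ⟨W, hWslow, hW⟩ := exists_slow_substInv hU hslow (fun x hx => (hh x hx).1)
    (fun x hx => (hh x hx).2.1)
  -- The linear coefficients of `h` and of its compositional inverse have product 1.
  have hW1 : ∀ x ∈ U, PowerSeries.coeff 1 (W x) ≠ 0 := by
    intro x hx h1
    have h2 := (hW x hx).2.1
    have hs : HasSubst (W x) := HasSubst.of_constantCoeff_zero' (hW x hx).1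
    rw [eq_X_mul_of_constantCoeff_eq_zero (hh x hx).1, subst_mul hs, subst_X hs] at h2
    have h3 := congrArg (PowerSeries.coeff 1) h2
    rw [eq_X_mul_of_constantCoeff_eq_zero (hW x hx).1, mul_assoc] at h3
    simp [coeff_succ_X_mul, h1] at h3
  obtain ⟨V, hVslow, hV⟩ := exists_slow_inv hU
    (G := fun x => PowerSeries.mk fun i => PowerSeries.coeff (i + 1) (W x))
    (fun i => by simpa using hWslow (i + 1)) (fun x hx => by
      rw [← coeff_zero_eq_constantCoeff_apply, coeff_mk]; exact hW1 x hx)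
  refine ⟨W, V, hVslow, fun x hx => ?_⟩
  obtain ⟨hW0, hWr, hWl⟩ := hW x hx
  have hWne : W x ≠ 0 := fun h => hW1 x hx (by rw [h, map_zero])
  refine ⟨?_, ?_, ⟨hW0, hWne, (laurentSubst_eq_iff (q := fun b => puncture f₀ b x)
    (hh x hx).2.2.1 (hh x hx).2.2.2 hW0 hWne).2 hWr⟩, ?_⟩
  · refine inv_eq_of_mul_eq_one_left ?_
    conv_lhs => rw [eq_X_mul_of_constantCoeff_eq_zero hW0]
    rw [PowerSeries.coe_mul, PowerSeries.coe_X, mul_mul_mul_comm, HahnSeries.single_mul_single,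
      ← PowerSeries.coe_mul, mul_comm (V x), hV x hx]
    simp
  · intro h0
    have := congrArg constantCoeff (hV x hx)
    simp [h0] at this
  -- A right inverse of `h` agrees with the left inverse `W x`.
  · intro W' h0 hW' e
    rw [laurentSubst_eq_iff (q := fun b => puncture f₀ b x) (hh x hx).2.2.1 (hh x hx).2.2.2] at e
    have hs : HasSubst (h x) := HasSubst.of_constantCoeff_zero' (hh x hx).1
    have hs' : HasSubst W' := HasSubst.of_constantCoeff_zero' h0
    calc W' = (X : PowerSeries ℂ).subst W' := (subst_X hs').symm
      _ = PowerSeries.subst W' (PowerSeries.subst (h x) (W x)) := by rw [hWl]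
      _ = PowerSeries.subst (PowerSeries.subst W' (h x)) (W x) := subst_comp_subst_apply hs hs' _
      _ = W x := by rw [e, X_subst]

lemma isLaxFunction_iff (hreg : ∀ a i, IsSlowFunction U (f₀ a i)) (hU : IsSlowOpen U)
    {x : Slow N} (hx : x ∈ U) (n₀ : ℝ) (a : Idx N) (z : LaurentSeries ℂ) :
    IsLaxFunction (puncture f₀) (leadingPhase n₀ f₀) a x z ↔
      ∃ (W : PowerSeries ℂ) (h0 : constantCoeff W = 0) (hW : W ≠ 0),
        z = (W : LaurentSeries ℂ) ^ (-sg a) ∧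
        laurentSubst W h0 hW (timeSer f₀ one 1 a x) = pAt (fun b => puncture f₀ b x) a := by
  have hd := hasTimeDeriv_leadingPhase hreg hU hx n₀ one 1 a
  constructor
  · rintro ⟨h1, P, hP, -, e⟩
    obtain ⟨W, h0, hzW⟩ := eq_coe_of_coeff_nonpos h1
    rw [hP.unique hd, hzW] at e
    have hW : W ≠ 0 := by
      rintro rfl
      obtain ⟨c, hc⟩ := comp_zero_eq_C (timeSer f₀ one 1 a x)
      rw [PowerSeries.coe_zero] at e
      exact pAt_ne_C _ a c (hc.symm.trans e)
    exact ⟨W, h0, hW, by rw [← hzW, zpow_neg_sg_zpow_neg_sg], by rw [← comp_coe, e]⟩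
  · rintro ⟨W, h0, hW, rfl, e⟩
    refine ⟨fun i hi => ?_, _, hd, rfl, ?_⟩
    · rw [zpow_neg_sg_zpow_neg_sg, PowerSeries.coeff_coe]
      rcases hi.lt_or_eq with hi | rfl
      · rw [if_pos hi]
      · simpa using h0
    · rw [zpow_neg_sg_zpow_neg_sg, comp_coe h0 hW, e]

end Lax

/-! ## The Orlov–Schulman functions -/

section Orlov

open PowerSeries

lemma single_mul_derivative_coe (G : PowerSeries ℂ) :
    HahnSeries.single 1 1 * LaurentSeries.derivative ℂ (G : LaurentSeries ℂ) =
      ((X * d⁄dX ℂ G : PowerSeries ℂ) : LaurentSeries ℂ) := by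
  ext i
  rw [coeff_single_mul', LaurentSeries.derivative_apply, LaurentSeries.hasseDeriv_coeff,
    PowerSeries.coeff_coe, PowerSeries.coeff_coe]
  rcases lt_or_ge i 0 with hi | hi
  · simp [hi]
  · obtain ⟨m, rfl⟩ := Int.eq_ofNat_of_zero_le hi
    cases m with
    | zero => simp
    | succ m =>
      have h1 : (((m + 1 : ℕ) : ℤ) - 1 + ((1 : ℕ) : ℤ)).natAbs = m + 1 := by omega
      have h2 : ((m + 1 : ℕ) : ℤ).natAbs = m + 1 := by omega
      rw [if_neg (by omega), if_neg (by omega), h1, h2, coeff_succ_X_mul, coeff_derivative]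
      simp [mul_comm]

lemma single_mul_derivative_single (k : ℤ) (c : ℂ) :
    (HahnSeries.single 1 1 * LaurentSeries.derivative ℂ (HahnSeries.single k c) :
      LaurentSeries ℂ) = (k * c) • HahnSeries.single k 1 := by
  rw [LaurentSeries.derivative_apply, LaurentSeries.hasseDeriv_single, ← HahnSeries.C_mul_eq_smul,
    HahnSeries.C_apply, HahnSeries.single_mul_single]
  simp

variable {N : ℕ} {f₀ : Idx N → ℕ → Slow N → ℂ}

lemma sub_smul_mul_coe (c : ℂ) (A F : LaurentSeries ℂ) (T : PowerSeries ℂ) :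
    A - c • (F * (T : LaurentSeries ℂ)) =
      A + F * ((C (-c) * T : PowerSeries ℂ) : LaurentSeries ℂ) := by
  rw [PowerSeries.coe_mul, PowerSeries.coe_C, mul_left_comm, HahnSeries.C_mul_eq_smul]
  ext i
  rw [HahnSeries.coeff_sub, HahnSeries.coeff_add, HahnSeries.coeff_smul, HahnSeries.coeff_smul]
  simp only [smul_eq_mul]
  ring

lemma dz_leadingPhase (n₀ : ℝ) (a : Idx N) (x : Slow N) :
    (leadingPhase n₀ f₀ a x).dz (sg a) = (sg a : ℂ) • (HahnSeries.single (sg a) 1 *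
      (HahnSeries.C ((sg a : ℂ) * n₀ + (x.1.1 a : ℝ)) +
        (x.1.2 a).sum (fun j t => ((j : ℕ) * t : ℂ) • (HahnSeries.single (-(j : ℤ)) 1 :
          LaurentSeries ℂ)) -
        ((X * d⁄dX ℂ (PowerSeries.mk fun i => f₀ a i x) : PowerSeries ℂ) : LaurentSeries ℂ))) := by
  simp only [Phase.dz, leadingPhase]
  rw [map_add (LaurentSeries.derivative ℂ), mul_add, single_mul_derivative_coe]
  congr 2
  rw [sub_add_eq_sub_sub]
  congr 1
  rw [sub_eq_add_neg]
  congr 1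
  simp only [Finsupp.sum, map_sum, Finset.mul_sum, single_mul_derivative_single]
  rw [← Finset.sum_neg_distrib]
  refine Finset.sum_congr rfl fun j _ => ?_
  rw [← neg_smul]
  push_cast
  ring_nf

/-- The operator `w d/dw` kills the constant term of the regular part of the phase, which is why `ν`
has none. -/
lemma exists_orlov_eq (n₀ : ℝ) (a : Idx N) (x : Slow N) {W : PowerSeries ℂ}
    (h0 : constantCoeff W = 0) (hW : W ≠ 0) {z : LaurentSeries ℂ}
    (hz : z = (W : LaurentSeries ℂ) ^ (-sg a)) :
    ∃ ν : PowerSeries ℂ, constantCoeff ν = 0 ∧ orlov (leadingPhase n₀ f₀) a x z =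
      ((n₀ + sg a * x.1.1 a : ℝ) : ℂ) • z⁻¹ +
        (sg a : ℂ) • (x.1.2 a).sum
          (fun j t => ((j : ℕ) * t : ℂ) • z ^ (sg a * (j : ℤ) - 1)) +
        z⁻¹ * (ν : LaurentSeries ℂ) := by
  have hWne : (W : LaurentSeries ℂ) ≠ 0 := fun h =>
    hW (HahnSeries.ofPowerSeries_injective (Γ := ℤ) (by simpa using h))
  have hs : HasSubst W := HasSubst.of_constantCoeff_zero' h0
  set θ : PowerSeries ℂ := X * d⁄dX ℂ (PowerSeries.mk fun i => f₀ a i x)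
  refine ⟨C (-(sg a : ℂ)) * θ.subst W, ?_, ?_⟩
  · have : constantCoeff (θ.subst W) = 0 := constantCoeff_subst_eq_zero h0 θ (by simp [θ])
    exact (map_mul constantCoeff _ _).trans (by rw [this, mul_zero])
  · have hzi : z⁻¹ = (W : LaurentSeries ℂ) ^ sg a := by rw [hz, zpow_neg, inv_inv]
    have hsg : (sg a : ℂ) * sg a = 1 := by exact_mod_cast sg_mul_self a
    rw [orlov, hz, zpow_neg_sg_zpow_neg_sg, comp_coe h0 hW, dz_leadingPhase, laurentSubst_smul,
      map_mul, map_sub, map_add, laurentSubst_single, laurentSubst_C, laurentSubst_coe, ← hz, hzi,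
      mul_sub, mul_add, smul_sub, smul_add, sub_smul_mul_coe]
    congr 2
    · rw [mul_comm, HahnSeries.C_mul_eq_smul, smul_smul]
      congr 1
      push_cast
      linear_combination (n₀ : ℂ) * hsg
    · simp only [Finsupp.sum, map_sum, Finset.mul_sum]
      congr 1
      refine Finset.sum_congr rfl fun j _ => ?_
      rw [laurentSubst_smul, laurentSubst_single, mul_smul_laurent, hz, ← zpow_mul,
        ← zpow_add₀ hWne]
      congr 2
      have := sg_mul_self a
      linear_combination (j : ℤ) * this

/-- Every series without constant term in `1 / p` is such a series in `1 / (p - q)`. -/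
lemma exists_comp_inv_eq (q : ℂ) {ν : PowerSeries ℂ} (hν : constantCoeff ν = 0) :
    ∃ μ : PowerSeries ℂ, constantCoeff μ = 0 ∧
      comp (μ : LaurentSeries ℂ) (HahnSeries.single (-1) 1 - HahnSeries.C q)⁻¹ = ν := by
  -- `η` is `1 / (p - q)` expanded in `1 / p`; composing `ν` with the inverse of `η` gives `μ`.
  set η : PowerSeries ℂ := X * (1 - C q * X)⁻¹ with hη
  have hη0 : constantCoeff η = 0 := by simp [hη]
  have hη1 : coeff 1 η = 1 := by
    rw [hη, show (1 : ℕ) = 0 + 1 from rfl, coeff_succ_X_mul, coeff_zero_eq_constantCoeff_apply]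
    simp
  have hηne : η ≠ 0 := fun h => by simp [h] at hη1
  have hs : HasSubst η := HasSubst.of_constantCoeff_zero' hη0
  have hu : IsUnit (coeff 1 η) := by rw [hη1]; exact isUnit_one
  have hκ : HasSubst (η.substInvOfIsUnit hu) := HasSubst.substInvOfIsUnit η hu
  have e : (HahnSeries.single (-1) 1 - HahnSeries.C q : LaurentSeries ℂ)⁻¹ =
      (η : LaurentSeries ℂ) := by
    refine inv_eq_of_mul_eq_one_left ?_
    have h1 : (HahnSeries.single (-1) 1 - HahnSeries.C q : LaurentSeries ℂ) =
        HahnSeries.single (-1) 1 * ((1 - C q * X : PowerSeries ℂ) : LaurentSeries ℂ) := by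
      rw [PowerSeries.coe_sub, PowerSeries.coe_mul, PowerSeries.coe_C, PowerSeries.coe_X,
        PowerSeries.coe_one, mul_sub, mul_left_comm, HahnSeries.single_mul_single]
      simp
    rw [h1, hη, PowerSeries.coe_mul, PowerSeries.coe_X, mul_mul_mul_comm,
      HahnSeries.single_mul_single, ← PowerSeries.coe_mul, mul_comm (1 - C q * X)⁻¹,
      PowerSeries.mul_inv_cancel _ (by simp)]
    simp
  refine ⟨ν.subst (η.substInvOfIsUnit hu), ?_, ?_⟩
  · exact constantCoeff_subst_eq_zero (constantCoeff_substInvOfIsUnit η hu) ν hν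
  · rw [e, comp_coe hη0 hηne, laurentSubst_coe, subst_comp_subst_apply hκ hs,
      subst_substInvOfIsUnit_left η hη0]
    rw [X_subst]

end Orlov

/-! ## The Whitham hierarchy -/

section Whitham

variable {N : ℕ} [NeZero N]

lemma Omega_eq_sum {q : Idx N → ℂ} {Z : Idx N → LaurentSeries ℂ} {a : Idx N} (ha : a ≠ one)
    {j : ℕ} {c : Fin j → ℂ} (hc : ∀ i : Fin j, (Z a ^ j).coeff (-((i + 1 : ℕ) : ℤ)) = c i)
    (P : LaurentSeries ℂ) :
    Omega q Z a j P = ∑ i : Fin j, c i • (P - HahnSeries.C (q a))⁻¹ ^ ((i : ℕ) + 1) := by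
  have h1 : Finset.Icc 1 j = Finset.Ico 1 (j + 1) := by
    ext n; simp only [Finset.mem_Icc, Finset.mem_Ico]; omega
  rw [Omega, if_neg ha, h1, Finset.sum_Ico_eq_sum_range, Nat.add_sub_cancel,
    ← Fin.sum_univ_eq_sum_range (fun n => (Z a ^ j).coeff (-((1 + n : ℕ) : ℤ)) •
      (P - HahnSeries.C (q a))⁻¹ ^ (1 + n)) j]
  refine Finset.sum_congr rfl fun i _ => ?_
  rw [add_comm 1 (i : ℕ), hc]

lemma Omega_eq_eval₂ {q : Idx N → ℂ} {Z : Idx N → LaurentSeries ℂ} {j : ℕ}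
    {p : Polynomial ℂ} (hp : p.natDegree < j + 1)
    (hc : ∀ n ≤ j, (Z one ^ j).coeff (-(n : ℤ)) = p.coeff n) (P : LaurentSeries ℂ) :
    Omega q Z one j P = p.eval₂ HahnSeries.C P := by
  rw [Omega, if_pos rfl, Polynomial.eval₂_eq_sum_range' _ hp]
  refine Finset.sum_congr rfl fun n hn => ?_
  rw [hc n (by have := Finset.mem_range.1 hn; omega), HahnSeries.C_mul_eq_smul]

lemma pAt_sub_C_of_ne (q : Idx N → ℂ) {a : Idx N} (ha : a ≠ one) :
    pAt q a - HahnSeries.C (q a) = HahnSeries.single 1 1 := by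
  rw [pAt, if_neg ha, add_sub_cancel_left]

lemma single_inv_pow (k : ℕ) :
    (HahnSeries.single 1 1 : LaurentSeries ℂ)⁻¹ ^ k = HahnSeries.single (-(k : ℤ)) 1 := by
  rw [single_zpow_one (-(k : ℤ)), zpow_neg, zpow_natCast, inv_pow]

variable {ε₀ : ℝ} {U : Set (Slow N)} {S Sb : ℝ → Slow N → Op N} {n : ℝ → ℤ}
  {f : Idx N → ℕ → ℝ → Slow N → ℂ} {f₀ : Idx N → ℕ → Slow N → ℂ}

omit [NeZero N] in
lemma laurentSubst_timeSer_self {W : PowerSeries ℂ} (h0 : PowerSeries.constantCoeff W = 0)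
    (hW : W ≠ 0) (a : Idx N) (j : ℕ+) (x : Slow N) :
    laurentSubst W h0 hW (timeSer f₀ a j a x) = (W : LaurentSeries ℂ)⁻¹ ^ (j : ℕ) +
      ((PowerSeries.subst W (serDeriv (dirT a j 1) f₀ a x) : PowerSeries ℂ) :
        LaurentSeries ℂ) := by
  rw [timeSer, if_pos rfl, map_add, laurentSubst_single, laurentSubst_coe, zpow_neg, zpow_natCast,
    inv_pow]

/-- The time flows of the Whitham hierarchy. -/
lemma IsQuasiclassical.laurentSubst_timeSer (hf : IsQuasiclassical ε₀ U S Sb n f f₀) (hε₀ : 0 < ε₀)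
    (hT : ∀ ε ∈ Set.Ioo 0 ε₀, IsTodaSolution ε U (S ε) (Sb ε)) (hU : IsSlowOpen U)
    {x : Slow N} (hx : x ∈ U) {W : Idx N → PowerSeries ℂ}
    (h0 : ∀ a, PowerSeries.constantCoeff (W a) = 0) (hW : ∀ a, W a ≠ 0)
    (hp : ∀ a, laurentSubst (W a) (h0 a) (hW a) (timeSer f₀ one 1 a x) =
      pAt (fun b => puncture f₀ b x) a) (a : Idx N) (j : ℕ+) (b : Idx N) :
    laurentSubst (W b) (h0 b) (hW b) (timeSer f₀ a j b x) =
      Omega (fun c => puncture f₀ c x) (fun c => (W c : LaurentSeries ℂ)⁻¹) a j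
        (pAt (fun c => puncture f₀ c x) b) := by
  by_cases ha : a = one
  · subst ha
    -- Any index other than 1 can be the partner of the shift; a barred one exists even for `N = 1`.
    -- The resulting polynomial in `p - q` is then re-expanded in `p`.
    have hb : (Sum.inr 0 : Idx N) ≠ one := by simp [one]
    obtain ⟨c, hc⟩ := hf.timeSer_eq hε₀ hT hU hx (Ne.symm hb) j (m := j + 1) (s := 0) rfl
      (fun _ => rfl) (fun h => absurd rfl h)
    set q := puncture f₀ (Sum.inr 0) x
    set p : Polynomial ℂ := ∑ i : Fin ((j : ℕ) + 1),
      Polynomial.C (c i) * (Polynomial.X - Polynomial.C q) ^ (i : ℕ) with hpdef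
    have hdeg : p.natDegree < (j : ℕ) + 1 := by
      refine Nat.lt_succ_of_le (Polynomial.natDegree_sum_le_of_forall_le _ _ fun i _ => ?_)
      refine (Polynomial.natDegree_C_mul_le _ _).trans ?_
      refine Polynomial.natDegree_pow_le.trans ?_
      rw [Polynomial.natDegree_X_sub_C, mul_one]
      exact Nat.le_of_lt_succ i.2
    have haeval : ∀ d, laurentSubst (W d) (h0 d) (hW d) (timeSer f₀ one j d x) =
        p.eval₂ HahnSeries.C (pAt (fun c => puncture f₀ c x) d) := by
      intro d
      rw [hc d, hpdef, map_sum, Polynomial.eval₂_finsetSum]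
      refine Finset.sum_congr rfl fun i _ => ?_
      rw [hf.chargeExp_eq hε₀ hT hU hx hb, laurentSubst_smul, map_pow, map_sub, hp,
        laurentSubst_C, Polynomial.eval₂_mul, Polynomial.eval₂_pow, Polynomial.eval₂_sub,
        Polynomial.eval₂_C, Polynomial.eval₂_X, Polynomial.eval₂_C, add_zero,
        ← HahnSeries.C_mul_eq_smul]
    rw [haeval b]
    -- The polynomial is read off at infinity, where the time derivative is `Zʲ` plus a series in
    -- positive powers. The normalization at the puncture 1 removes the constant term, so the
    -- projection includes `n = 0`.
    refine (Omega_eq_eval₂ hdeg (fun m hm => ?_) _).symm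
    have h1 := haeval one
    rw [laurentSubst_timeSer_self, Polynomial.eval₂_eq_sum_range' _ hdeg, pAt, if_pos rfl] at h1
    have hser : PowerSeries.constantCoeff
        (PowerSeries.subst (W one) (serDeriv (dirT one j 1) f₀ one x) : PowerSeries ℂ) = 0 := by
      refine PowerSeries.constantCoeff_subst_eq_zero (h0 one) _ ?_
      rw [← PowerSeries.coeff_zero_eq_constantCoeff_apply, serDeriv, PowerSeries.coeff_mk,
        hf.slowDeriv_normalized hε₀ hU hx]
    have h2 := congrArg (fun F : LaurentSeries ℂ => F.coeff (-(m : ℤ))) h1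
    have h3 : (((PowerSeries.subst (W one) (serDeriv (dirT one j 1) f₀ one x) : PowerSeries ℂ) :
        LaurentSeries ℂ)).coeff (-(m : ℤ)) = 0 := by
      rw [PowerSeries.coeff_coe]
      cases m with
      | zero => simpa using hser
      | succ m => rw [if_pos (by omega)]
    simp only [HahnSeries.coeff_add, h3, add_zero, HahnSeries.C_mul_eq_smul] at h2
    rw [h2, HahnSeries.coeff_sum, Finset.sum_eq_single m]
    · simp
    · intro i _ hi
      simp [Ne.symm hi]
    · intro hm'
      exact absurd (Finset.mem_range.2 (by omega)) hm'
  · obtain ⟨c, hc⟩ := hf.timeSer_eq hε₀ hT hU hx ha j (m := j) (s := 1) rfl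
      (fun h => absurd h ha) (fun _ => ⟨rfl, rfl⟩)
    have hsum : ∀ d, laurentSubst (W d) (h0 d) (hW d) (timeSer f₀ a j d x) =
        ∑ i : Fin (j : ℕ), c i • (pAt (fun c => puncture f₀ c x) d -
          HahnSeries.C (puncture f₀ a x))⁻¹ ^ ((i : ℕ) + 1) := by
      intro d
      rw [hc d, map_sum]
      refine Finset.sum_congr rfl fun i _ => ?_
      rw [hf.chargeExp_eq_inv hε₀ hT hU hx ha, laurentSubst_smul, map_pow, map_inv₀, map_sub, hp,
        laurentSubst_C]
    rw [hsum b]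
    refine (Omega_eq_sum (q := fun c => puncture f₀ c x) ha (fun i => ?_) _).symm
    -- At the puncture `a` the time derivative is `Z_aʲ` plus a regular series, so the `c i` are the
    -- coefficients of the principal part of `Z_aʲ`.
    have h1 := hsum a
    rw [laurentSubst_timeSer_self, pAt_sub_C_of_ne (fun c => puncture f₀ c x) ha] at h1
    have h2 := congrArg (fun F : LaurentSeries ℂ => F.coeff (-((i + 1 : ℕ) : ℤ))) h1
    simp only [HahnSeries.coeff_add, PowerSeries.coeff_coe] at h2
    rw [if_pos (by omega), add_zero] at h2
    rw [h2, HahnSeries.coeff_sum, Finset.sum_eq_single i]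
    · simp
    · intro k _ hk
      have : (k : ℕ) ≠ i := fun h => hk (Fin.ext h)
      simp only [single_inv_pow, HahnSeries.coeff_smul]
      rw [HahnSeries.coeff_single_of_ne (by omega), smul_zero]
    · simp

omit [NeZero N] in
lemma zpow_neg_sg_zpow_sg (a : Idx N) (F : LaurentSeries ℂ) : (F ^ (-sg a)) ^ sg a = F⁻¹ := by
  rw [← zpow_mul, neg_mul, sg_mul_self, zpow_neg_one]

lemma coe_eq_C_add_single_mul (V : PowerSeries ℂ) : ∃ r : PowerSeries ℂ, (V : LaurentSeries ℂ) =
    HahnSeries.C (PowerSeries.constantCoeff V) + HahnSeries.single 1 1 * (r : LaurentSeries ℂ) :=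
  ⟨_, by
    rw [← PowerSeries.coe_C, ← PowerSeries.coe_X, ← PowerSeries.coe_mul, ← PowerSeries.coe_add,
      ← eq_C_add_X_mul V]⟩

/-- Here `p` is `Z` plus a series in `W` whose constant term vanishes by the normalization; this is
the reason for `ℓ_{1,0} = 0`. -/
lemma IsQuasiclassical.expansion_one (hf : IsQuasiclassical ε₀ U S Sb n f f₀) (hε₀ : 0 < ε₀)
    (hU : IsSlowOpen U) {x : Slow N} (hx : x ∈ U) {W : PowerSeries ℂ}
    (h0 : PowerSeries.constantCoeff W = 0) (hW : W ≠ 0)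
    (hp : laurentSubst W h0 hW (timeSer f₀ one 1 one x) = pAt (fun b => puncture f₀ b x) one) :
    ∃ r : PowerSeries ℂ, (W : LaurentSeries ℂ)⁻¹ =
      HahnSeries.single (-1) 1 + HahnSeries.single 1 1 * (r : LaurentSeries ℂ) := by
  rw [laurentSubst_timeSer_self, pAt, if_pos rfl, PNat.one_coe, pow_one] at hp
  have hser : PowerSeries.constantCoeff
      (PowerSeries.subst W (serDeriv (dirT one 1 1) f₀ one x) : PowerSeries ℂ) = 0 := by
    refine PowerSeries.constantCoeff_subst_eq_zero h0 _ ?_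
    rw [← PowerSeries.coeff_zero_eq_constantCoeff_apply, serDeriv, PowerSeries.coeff_mk,
      hf.slowDeriv_normalized hε₀ hU hx]
  obtain ⟨r, hr⟩ := coe_eq_C_add_single_mul
    (PowerSeries.subst W (serDeriv (dirT one 1 1) f₀ one x) : PowerSeries ℂ)
  rw [hser, map_zero, zero_add] at hr
  rw [hr] at hp
  refine ⟨PowerSeries.C (-1) * r, ?_⟩
  rw [← sub_smul_mul_coe, one_smul]
  exact eq_sub_of_add_eq hp

lemma expansion_ne {Z : LaurentSeries ℂ} {V : PowerSeries ℂ}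
    (hZ : Z = HahnSeries.single (-1) 1 * (V : LaurentSeries ℂ)) :
    ∃ r : PowerSeries ℂ, Z =
      HahnSeries.single (-1) (PowerSeries.constantCoeff V) + (r : LaurentSeries ℂ) := by
  obtain ⟨r, hr⟩ := coe_eq_C_add_single_mul V
  refine ⟨r, ?_⟩
  rw [hZ, hr, mul_add, ← mul_assoc, HahnSeries.single_mul_single, HahnSeries.C_apply,
    HahnSeries.single_mul_single]
  simp

end Whitham

end WhithamKP

end

/-! ### The proposition: Lax functions, Orlov–Schulman functions and the Whitham flows -/

open WhithamKP
theorem mainTheorem8 (N : ℕ) [NeZero N] (ε₀ : ℝ) (hε₀ : 0 < ε₀)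
    (U : Set (Slow N)) (hU : IsSlowOpen U)
    (S Sb : ℝ → Slow N → Op N)
    (hToda : ∀ ε ∈ Set.Ioo 0 ε₀, IsTodaSolution ε U (S ε) (Sb ε))
    (n : ℝ → ℤ) (n₀ : ℝ) (hn : Filter.Tendsto (fun ε : ℝ => ε * n ε) (𝓝[>] 0) (𝓝 n₀))
    (f : Idx N → ℕ → ℝ → Slow N → ℂ) (f₀ : Idx N → ℕ → Slow N → ℂ)
    (hf : IsQuasiclassical ε₀ U S Sb n f f₀) :
    ∃ z : Idx N → Slow N → LaurentSeries ℂ,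
      -- `z a x` is the dispersionless Lax function, and it is unique
      (∀ x ∈ U, ∀ a, IsLaxFunction (puncture f₀) (leadingPhase n₀ f₀) a x (z a x) ∧
        ∀ z', IsLaxFunction (puncture f₀) (leadingPhase n₀ f₀) a x z' → z' = z a x) ∧
      -- expansions of the Lax functions
      (∀ x ∈ U, ∃ (ℓ : ℂ) (r : PowerSeries ℂ), z one x ^ sg (one : Idx N) =
        HahnSeries.single (-1) 1 + HahnSeries.C ℓ +
          HahnSeries.single 1 1 * (r : LaurentSeries ℂ)) ∧
      (∀ x ∈ U, ∀ a, a ≠ one → ∃ (ℓ₁ ℓ₀ : ℂ) (r : PowerSeries ℂ), ℓ₁ ≠ 0 ∧ z a x ^ sg a =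
        HahnSeries.single (-1) ℓ₁ + HahnSeries.C ℓ₀ +
          HahnSeries.single 1 1 * (r : LaurentSeries ℂ)) ∧
      -- expansions of the Orlov–Schulman functions
      (∀ x ∈ U, ∀ a₀ : Idx N, a₀ ≠ one → ∃ μ : PowerSeries ℂ,
        PowerSeries.constantCoeff μ = 0 ∧
        orlov (leadingPhase n₀ f₀) one x (z one x) =
          ((n₀ + sg (one : Idx N) * x.1.1 one : ℝ) : ℂ) • (z one x)⁻¹ +
          (x.1.2 one).sum (fun j t => ((j : ℕ) * t : ℂ) • z one x ^ ((j : ℤ) - 1)) +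
          (z one x)⁻¹ * comp (μ : LaurentSeries ℂ)
            (pAt (fun b => puncture f₀ b x) one - HahnSeries.C (puncture f₀ a₀ x))⁻¹) ∧
      (∀ x ∈ U, ∀ a, a ≠ one → ∃ μ : PowerSeries ℂ,
        PowerSeries.constantCoeff μ = 0 ∧
        orlov (leadingPhase n₀ f₀) a x (z a x) =
          ((n₀ + sg a * x.1.1 a : ℝ) : ℂ) • (z a x)⁻¹ +
          (sg a : ℂ) • (x.1.2 a).sum
            (fun j t => ((j : ℕ) * t : ℂ) • z a x ^ (sg a * (j : ℤ) - 1)) +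
          (z a x)⁻¹ * comp (μ : LaurentSeries ℂ)
            (pAt (fun b => puncture f₀ b x) a - HahnSeries.C (puncture f₀ a x))) ∧
      -- the leading phases solve the Whitham hierarchy in the KP picture
      IsKPWhithamSolution U (puncture f₀) (fun a x => z a x ^ sg a) (leadingPhase n₀ f₀) := by
  have hreg := hf.regular_limit
  -- `W a x` is `z_a ^ (-sg a)` in the local parameter `ξ`, and `V a x` is the power series with
  -- `Z_a = ξ⁻¹ V`.
  choose W V hV hWV using fun a => hf.exists_localCoord hε₀ hToda hU a
  have hinv : ∀ x ∈ U, ∀ a, (W a x : LaurentSeries ℂ)⁻¹ =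
      HahnSeries.single (-1) 1 * (V a x : LaurentSeries ℂ) := fun x hx a => (hWV a x hx).1
  have hV0 : ∀ x ∈ U, ∀ a, PowerSeries.constantCoeff (V a x) ≠ 0 := fun x hx a => (hWV a x hx).2.1
  have h0 : ∀ x ∈ U, ∀ a, PowerSeries.constantCoeff (W a x) = 0 := fun x hx a =>
    (hWV a x hx).2.2.1.choose
  have hW : ∀ x ∈ U, ∀ a, W a x ≠ 0 := fun x hx a => (hWV a x hx).2.2.1.choose_spec.choose
  have hp : ∀ x (hx : x ∈ U) a, laurentSubst (W a x) (h0 x hx a) (hW x hx a)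
      (timeSer f₀ one 1 a x) = pAt (fun b => puncture f₀ b x) a := fun x hx a =>
    (hWV a x hx).2.2.1.choose_spec.choose_spec
  have hq : ∀ a, IsSlowFunction U (puncture f₀ a) := fun a => (hreg one 1).slowDeriv hU _
  refine ⟨fun a x => (W a x : LaurentSeries ℂ) ^ (-sg a), fun x hx a => ⟨?_, fun z' hz' => ?_⟩,
    fun x hx => ?_, fun x hx a ha => ?_, fun x hx a₀ ha₀ => ?_, fun x hx a ha => ?_, ?_⟩
  · exact (isLaxFunction_iff hreg hU hx n₀ a _).2
      ⟨W a x, h0 x hx a, hW x hx a, rfl, hp x hx a⟩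
  · obtain ⟨W', h0', hW', rfl, e⟩ := (isLaxFunction_iff hreg hU hx n₀ a _).1 hz'
    rw [(hWV a x hx).2.2.2 W' h0' hW' e]
  · obtain ⟨r, hr⟩ := hf.expansion_one hε₀ hU hx _ _ (hp x hx one)
    exact ⟨0, r, by rw [zpow_neg_sg_zpow_sg, hr, map_zero, add_zero]⟩
  · obtain ⟨r, hr⟩ := expansion_ne (hinv x hx a)
    obtain ⟨r', hr'⟩ := coe_eq_C_add_single_mul r
    exact ⟨_, _, r', hV0 x hx a, by rw [zpow_neg_sg_zpow_sg, hr, hr', add_assoc]⟩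
  · obtain ⟨ν, hν, e⟩ := exists_orlov_eq (f₀ := f₀) n₀ one x (h0 x hx one) (hW x hx one) rfl
    obtain ⟨μ, hμ, hμν⟩ := exists_comp_inv_eq (puncture f₀ a₀ x) hν
    refine ⟨μ, hμ, ?_⟩
    have hs : sg (one : Idx N) = 1 := rfl
    have hpone : pAt (fun b => puncture f₀ b x) one = HahnSeries.single (-1) 1 := if_pos rfl
    rw [e, hpone, hμν]
    simp only [hs, Int.cast_one, one_smul, one_mul]
  · obtain ⟨ν, hν, e⟩ := exists_orlov_eq (f₀ := f₀) n₀ a x (h0 x hx a) (hW x hx a) rfl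
    -- At a finite puncture the local parameter is `p - q_a` itself, so no change of parameter is
    -- needed.
    refine ⟨ν, hν, ?_⟩
    rw [e, pAt_sub_C_of_ne (fun b => puncture f₀ b x) ha, ← PowerSeries.coe_X,
      comp_coe (by simp) PowerSeries.X_ne_zero, laurentSubst_coe, PowerSeries.X_subst]
  · have hZ : ∀ a x, ((W a x : LaurentSeries ℂ) ^ (-sg a)) ^ sg a = (W a x : LaurentSeries ℂ)⁻¹ :=
      fun a x => zpow_neg_sg_zpow_sg a _
    simp only [hZ]
    refine ⟨fun x hx a b ha hb hab => hf.puncture_ne hε₀ hToda hU hx ha hb hab,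
      fun x hx => hf.expansion_one hε₀ hU hx _ _ (hp x hx one), fun x hx a _ => ?_,
      fun a _ => hq a, fun a i => ?_, fun x hx a j b => ?_, fun x hx a ha b => ?_⟩
    · obtain ⟨r, hr⟩ := expansion_ne (hinv x hx a)
      exact ⟨_, r, hV0 x hx a, hr⟩
    · have h1 : IsSlowFunction U fun x =>
          (HahnSeries.single (-1) 1 * (V a x : LaurentSeries ℂ) : LaurentSeries ℂ).coeff i := by
        simp only [coeff_single_mul_coe]
        split_ifs
        · exact isSlowFunction_const 0
        · exact hV a _
      exact h1.congr hU fun x hx => by rw [hinv x hx a]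
    · refine ⟨_, hasTimeDeriv_leadingPhase hreg hU hx n₀ a j b, rfl, ?_⟩
      rw [inv_inv, comp_coe (h0 x hx b) (hW x hx b)]
      exact hf.laurentSubst_timeSer hε₀ hToda hU hx (h0 x hx) (hW x hx) (hp x hx) a j b
    -- The power of `Z_b` is the charge of the shift at `b`; substituting `w = W b x` in
    -- `chargeExp_eq_inv` gives the flow.
    · refine ⟨_, dirZ a one b, _, hasChargeDeriv_leadingPhase hreg hU hx n₀ a b, rfl, rfl, ?_⟩
      have h1 := congrArg (laurentSubst (W b x) (h0 x hx b) (hW x hx b))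
        (hf.chargeExp_eq_inv hε₀ hToda hU hx ha b)
      rw [map_inv₀, map_sub, hp x hx, laurentSubst_C, chargeExp, map_mul, laurentSubst_single,
        zpow_neg] at h1
      rw [inv_inv, comp_coe (h0 x hx b) (hW x hx b), inv_zpow]
      exact h1
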